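/- Let $q\in\mathbb{C}$ with $|q|<1$. Write $(a;q)_\infty=\prod_{k\ge 0}(1-aq^k)$, $(a;q)_n=\prod_{k=0}^{n-1}(1-aq^k)$, and for integers $0<a<m$ $$J_m=(q^m;q^m)_\infty,\qquad J_{a,m}=(q^a;q^m)_\infty(q^{m-a};q^m)_\infty(q^m;q^m)_\infty .$$ Then the following twelve identities for triple sums over integers $i,j,k\ge 0$ hold, all the sums converging absolutely. (1) $$\sum_{i,j,k\ge 0}\frac{q^{i^2+3j^2+4k^2+2ij+4jk+i-2j}}{(q^2;q^2)_i(q^2;q^2)_j(q^4;q^4)_k}=\frac{J_4J_{14}J_{28}^2J_{2,28}}{J_2J_{1,28}J_{4,28}J_{8,28}J_{13,28}},$$ $$\sum_{i,j,k\ge 0}\frac{q^{i^2+3j^2+4k^2+2ij+4jk+i}}{(q^2;q^2)_i(q^2;q^2)_j(q^4;q^4)_k}=\frac{J_4J_{14}J_{28}^2J_{6,28}}{J_2J_{3,28}J_{4,28}J_{11,28}J_{12,28}},$$ $$\sum_{i,j,k\ge 0}\frac{q^{i^2+3j^2+4k^2+2ij+4jk+i+2j+4k}}{(q^2;q^2)_i(q^2;q^2)_j(q^4;q^4)_k}=\frac{J_4J_{14}J_{28}^2J_{10,28}}{J_2J_{5,28}J_{8,28}J_{9,28}J_{12,28}};$$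 (2) $$\sum_{i,j,k\ge 0}\frac{q^{i^2+4j^2+3k^2+2ij+4jk+i-2k}}{(q^2;q^2)_i(q^2;q^2)_j(q^4;q^4)_k}=\frac{J_4J_{14}J_{28}^2J_{2,28}}{J_2J_{1,28}J_{4,28}J_{8,28}J_{13,28}},$$ $$\sum_{i,j,k\ge 0}\frac{q^{i^2+4j^2+3k^2+2ij+4jk+i}}{(q^2;q^2)_i(q^2;q^2)_j(q^4;q^4)_k}=\frac{J_4J_{14}J_{28}^2J_{6,28}}{J_2J_{3,28}J_{4,28}J_{11,28}J_{12,28}},$$ $$\sum_{i,j,k\ge 0}\frac{q^{i^2+4j^2+3k^2+2ij+4jk+i+4j+2k}}{(q^2;q^2)_i(q^2;q^2)_j(q^4;q^4)_k}=\frac{J_4J_{14}J_{28}^2J_{10,28}}{J_2J_{5,28}J_{8,28}J_{9,28}J_{12,28}};$$ (3) $$\sum_{i,j,k\ge 0}\frac{q^{3i^2+6j^2+16k^2+4ij+8ik+16jk-2i-2j}}{(q^4;q^4)_i(q^4;q^4)_j(q^8;q^8)_k}=\frac{J_{14}J_{28}^2J_{2,28}}{J_{1,28}J_{4,28}J_{8,28}J_{13,28}},$$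 $$\sum_{i,j,k\ge 0}\frac{q^{3i^2+6j^2+16k^2+4ij+8ik+16jk-2j}}{(q^4;q^4)_i(q^4;q^4)_j(q^8;q^8)_k}=\frac{J_{14}J_{28}^2J_{6,28}}{J_{3,28}J_{4,28}J_{11,28}J_{12,28}},$$ $$\sum_{i,j,k\ge 0}\frac{q^{3i^2+6j^2+16k^2+4ij+8ik+16jk+2i+2j+8k}}{(q^4;q^4)_i(q^4;q^4)_j(q^8;q^8)_k}=\frac{J_{14}J_{28}^2J_{10,28}}{J_{5,28}J_{8,28}J_{9,28}J_{12,28}};$$ (4) $$\sum_{i,j,k\ge 0}\frac{q^{4i^2+5j^2+12k^2+4ij+8ik+12jk-4j-4k}}{(q^4;q^4)_i(q^4;q^4)_j(q^8;q^8)_k}=\frac{J_{14}J_{28}^2J_{2,28}}{J_{1,28}J_{4,28}J_{8,28}J_{13,28}},$$ $$\sum_{i,j,k\ge 0}\frac{q^{4i^2+5j^2+12k^2+4ij+8ik+12jk-2j}}{(q^4;q^4)_i(q^4;q^4)_j(q^8;q^8)_k}=\frac{J_{14}J_{28}^2J_{6,28}}{J_{3,28}J_{4,28}J_{11,28}J_{12,28}},$$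 $$\sum_{i,j,k\ge 0}\frac{q^{4i^2+5j^2+12k^2+4ij+8ik+12jk+4i+4k}}{(q^4;q^4)_i(q^4;q^4)_j(q^8;q^8)_k}=\frac{J_{14}J_{28}^2J_{10,28}}{J_{5,28}J_{8,28}J_{9,28}J_{12,28}}.$$ -/

import Mathlib

/-- The finite `q`-shifted factorial `(a; q)_n = ∏_{k=0}^{n-1} (1 - a q^k)`. -/
noncomputable def qPoch (a q : ℂ) (n : ℕ) : ℂ :=
  ∏ k ∈ Finset.range n, (1 - a * q ^ k)

/-- The infinite `q`-shifted factorial `(a; q)_∞ = ∏_{k=0}^∞ (1 - a q^k)`, for `|q| < 1`. -/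
noncomputable def qPochInf (a q : ℂ) : ℂ :=
  ∏' k : ℕ, (1 - a * q ^ k)

/-- The product defining `(a; q)_∞` converges (absolutely) for `|q| < 1`. -/
theorem multipliable_qPochInf (a : ℂ) {q : ℂ} (hq : ‖q‖ < 1) :
    Multipliable fun k : ℕ => 1 - a * q ^ k := by
  have h : Summable fun k : ℕ => ‖-(a * q ^ k)‖ := by
    simpa [norm_mul, norm_pow] using
      (summable_geometric_of_lt_one (norm_nonneg q) hq).mul_left ‖a‖
  simpa [sub_eq_add_neg] using multipliable_one_add_of_summable h

/-- `J_m = (q^m; q^m)_∞`. -/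
noncomputable def J (q : ℂ) (m : ℕ) : ℂ :=
  qPochInf (q ^ m) (q ^ m)

/-- `J_{a,m} = (q^a, q^{m-a}, q^m; q^m)_∞`, used for `0 < a < m`. -/
noncomputable def Jtheta (q : ℂ) (a m : ℕ) : ℂ :=
  qPochInf (q ^ a) (q ^ m) * qPochInf (q ^ (m - a)) (q ^ m) * qPochInf (q ^ m) (q ^ m)

/-- `q^{Q(i,j,k)} / ((q^r; q^r)_i (q^r; q^r)_j (q^{2r}; q^{2r})_k)`: the `(i, j, k)` term of a
triple sum of index `(1,1,2)` in base `q^r`, with integer-valued exponent `Q`. -/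
noncomputable def nahmTerm (q : ℂ) (r : ℕ) (Q : ℤ → ℤ → ℤ → ℤ) (n : ℕ × ℕ × ℕ) : ℂ :=
  q ^ Q n.1 n.2.1 n.2.2 /
    (qPoch (q ^ r) (q ^ r) n.1 * qPoch (q ^ r) (q ^ r) n.2.1 *
      qPoch (q ^ (2 * r)) (q ^ (2 * r)) n.2.2)

open Filter Topology Finset

/-! All four families collapse to the same double sum `nahmPairTerm`, with exponent `3i² + 4ij + 4j²
+ αi + βj` and both denominators in base `q⁴`, for `(α, β) = (-2, 0), (0, 0), (2, 4)`. In families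
(1) and (2) the sum over `i` is Euler's and costs the factor `(-q²; q²)_∞ = J_4 / J_2`
(`tsum_nahmTerm_two`). In families (3) and (4) the sum over `j + 2k = N` is a coefficient of `(-X;
q⁴)_∞ / (X²; q⁸)_∞ = 1 / (X; q⁴)_∞` (`tsum_nahmTerm_four`).

The exponent of the double sum is `(i + 2j)² + 2i²` plus linear terms, so only a coefficient of
`(-X; q⁴)_∞ / (X²; q⁴)_∞`, or of its variant with numerator `(-q²X; q⁴)_∞`, is needed for each `n =
i + 2j`. Refactoring this quotient and applying Euler once more (`tsum_pair_eq_tsum`) leaves a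
single sum of Rogers–Slater type in `s = -q`, with summand `s^{m²} (-s; s²)_m c_m / (s²; s²)_{2m}`
and, for `p = s²`, `c_m` one of `p^m`, `1`, `1 - p^{2m}`.

Such sums are evaluated by Bailey's method: `c_m` is expanded in Gaussian binomials of top index
`2m` (`tsum_qBinom_pow`, `tsum_qBinom_even`, `tsum_qBinom_one_sub`), and the conjugate sum over `m`
is a case of the `₁φ₁` summation (`hasSum_bailey`). The result is a difference of theta series with
quadratic part `21j²`, which the quintuple product identity in base `s^14` at `z = s^a`, `a = 1, 3,
5`, turns into products. The case `q = 0` is trivial and treated apart. -/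

/-! ### Shifted factorials: convergence, uniform bounds, dissection. -/

theorem qPoch_zero (a p : ℂ) : qPoch a p 0 = 1 := by simp [qPoch]

theorem qPoch_succ (a p : ℂ) (n : ℕ) : qPoch a p (n + 1) = qPoch a p n * (1 - a * p ^ n) := by
  simp [qPoch, prod_range_succ]

theorem qPoch_add (a p : ℂ) (m n : ℕ) :
    qPoch a p (m + n) = qPoch a p m * qPoch (a * p ^ m) p n := by
  simp [qPoch, prod_range_add, pow_add, mul_assoc]

theorem qPochInf_eq_mul (a : ℂ) {p : ℂ} (hp : ‖p‖ < 1) (n : ℕ) :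
    qPochInf a p = qPoch a p n * qPochInf (a * p ^ n) p := by
  have h : Multipliable fun k : ℕ => 1 - a * p ^ (k + n) := by
    refine (multipliable_qPochInf (a * p ^ n) hp).congr fun k => ?_
    rw [pow_add]; ring
  have h2 := Multipliable.prod_mul_tprod_nat_mul' (f := fun k : ℕ => 1 - a * p ^ k) h
  rw [qPochInf, ← h2, qPoch, qPochInf]
  congr 1
  refine tprod_congr fun k => ?_
  rw [pow_add]; ring

theorem tendsto_qPoch (a : ℂ) {p : ℂ} (hp : ‖p‖ < 1) :
    Tendsto (qPoch a p) atTop (𝓝 (qPochInf a p)) :=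
  (multipliable_qPochInf a hp).tendsto_prod_tprod_nat

theorem exists_norm_qPoch_le (a : ℂ) {p : ℂ} (hp : ‖p‖ < 1) :
    ∃ C, 0 < C ∧ ∀ n, ‖qPoch a p n‖ ≤ C := by
  obtain ⟨C, hC⟩ := (Metric.isBounded_range_of_tendsto _ (tendsto_qPoch a hp)).exists_norm_le
  exact ⟨max C 1, by positivity, fun n => (hC _ ⟨n, rfl⟩).trans (le_max_left _ _)⟩

theorem qPochInf_ne_zero {a p : ℂ} (hp : ‖p‖ < 1) (h : ∀ k : ℕ, a * p ^ k ≠ 1) :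
    qPochInf a p ≠ 0 := by
  have hs : Summable fun k : ℕ => ‖-(a * p ^ k)‖ := by
    simpa [norm_mul, norm_pow] using
      (summable_geometric_of_lt_one (norm_nonneg p) hp).mul_left ‖a‖
  have := tprod_one_add_ne_zero_of_summable (f := fun k : ℕ => -(a * p ^ k))
    (fun k => by rw [← sub_eq_add_neg]; exact sub_ne_zero.2 (h k).symm) hs
  simpa [qPochInf, sub_eq_add_neg] using this

theorem mul_pow_ne_one {a p : ℂ} (ha : ‖a‖ < 1) (hp : ‖p‖ < 1) (k : ℕ) : a * p ^ k ≠ 1 := by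
  intro h
  have h1 : ‖a * p ^ k‖ = 1 := by rw [h]; simp
  rw [norm_mul, norm_pow] at h1
  have := pow_le_one₀ (n := k) (norm_nonneg p) hp.le
  nlinarith [norm_nonneg a]

theorem qPochInf_ne_zero_of_norm_lt {a p : ℂ} (ha : ‖a‖ < 1) (hp : ‖p‖ < 1) :
    qPochInf a p ≠ 0 :=
  qPochInf_ne_zero hp (mul_pow_ne_one ha hp)

theorem qPoch_ne_zero {a p : ℂ} (ha : ‖a‖ < 1) (hp : ‖p‖ < 1) (n : ℕ) : qPoch a p n ≠ 0 :=
  prod_ne_zero_iff.2 fun k _ => sub_ne_zero.2 (mul_pow_ne_one ha hp k).symm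

theorem exists_norm_inv_qPoch_le {a p : ℂ} (ha : ‖a‖ < 1) (hp : ‖p‖ < 1) :
    ∃ C, 0 < C ∧ ∀ n, ‖(qPoch a p n)⁻¹‖ ≤ C := by
  obtain ⟨C, hC⟩ := (Metric.isBounded_range_of_tendsto _
    ((tendsto_qPoch a hp).inv₀ (qPochInf_ne_zero_of_norm_lt ha hp))).exists_norm_le
  exact ⟨max C 1, by positivity, fun n => (hC _ ⟨n, rfl⟩).trans (le_max_left _ _)⟩

theorem norm_pow_lt_one {q : ℂ} (hq : ‖q‖ < 1) {n : ℕ} (hn : n ≠ 0) : ‖q ^ n‖ < 1 := by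
  rw [norm_pow]; exact pow_lt_one₀ (norm_nonneg q) hq hn

/-- Dissection of an infinite product along residue classes. -/
theorem qPochInf_eq_prod (a : ℂ) {p : ℂ} (hp : ‖p‖ < 1) {n : ℕ} (hn : n ≠ 0) :
    qPochInf a p = ∏ i ∈ range n, qPochInf (a * p ^ i) (p ^ n) := by
  have hpn := norm_pow_lt_one hp hn
  have h1 : Tendsto (fun N => qPoch a p (n * N)) atTop (𝓝 (qPochInf a p)) :=
    (tendsto_qPoch a hp).comp (tendsto_id.const_mul_atTop' (Nat.pos_of_ne_zero hn))
  have h2 : Tendsto (fun N => ∏ i ∈ range n, qPoch (a * p ^ i) (p ^ n) N) atTop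
      (𝓝 (∏ i ∈ range n, qPochInf (a * p ^ i) (p ^ n))) :=
    tendsto_finsetProd _ fun i _ => tendsto_qPoch _ hpn
  refine tendsto_nhds_unique h1 (h2.congr fun N => ?_)
  induction N with
  | zero => simp [qPoch_zero]
  | succ N ih =>
    simp_rw [qPoch_succ, prod_mul_distrib, ih]
    rw [Nat.mul_succ, qPoch_add]
    congr 1
    refine prod_congr rfl fun i _ => ?_
    rw [← pow_mul]; ring

theorem qPochInf_sq (x : ℂ) {p : ℂ} (hp : ‖p‖ < 1) :
    qPochInf (x ^ 2) (p ^ 2) = qPochInf x p * qPochInf (-x) p := by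
  have hp2 := norm_pow_lt_one hp two_ne_zero
  refine tendsto_nhds_unique (tendsto_qPoch _ hp2)
    (((tendsto_qPoch x hp).mul (tendsto_qPoch (-x) hp)).congr fun N => ?_)
  rw [qPoch, qPoch, qPoch, ← prod_mul_distrib]
  refine prod_congr rfl fun k _ => ?_
  ring

/-! ### Euler's expansion. -/

/-- The family `t^{n(n-1)} (-y)^n / (t²; t²)_n` is summable. -/
theorem summable_euler {t : ℂ} (ht : ‖t‖ < 1) (y : ℂ) :
    Summable fun n : ℕ => ‖t ^ (n * (n - 1)) * (-y) ^ n / qPoch (t ^ 2) (t ^ 2) n‖ := by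
  have ht2 := norm_pow_lt_one ht two_ne_zero
  obtain ⟨C, hC0, hC⟩ := exists_norm_inv_qPoch_le ht2 ht2
  have hlim : Tendsto (fun n : ℕ => ‖t‖ ^ n * ‖y‖) atTop (𝓝 0) := by
    simpa using (tendsto_pow_atTop_nhds_zero_of_lt_one (norm_nonneg t) ht).mul_const ‖y‖
  have hs : Summable fun n : ℕ => C * (1 / 2 : ℝ) ^ n :=
    summable_geometric_two.mul_left C
  refine hs.of_norm_bounded_eventually_nat ?_
  -- Since `t^{n(n-1)} y^n = (t^{n-1} y)^n` and the base tends to `0`, the terms are eventually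
  -- dominated by `C / 2^n`.
  have h1 := hlim.eventually (eventually_le_nhds (by norm_num : (0 : ℝ) < 1 / 2))
  filter_upwards [(tendsto_sub_atTop_nat 1).eventually h1] with n hn
  rw [norm_norm, div_eq_mul_inv, norm_mul, mul_comm]
  refine mul_le_mul (hC n) ?_ (norm_nonneg _) hC0.le
  rw [norm_mul, norm_pow, norm_pow, norm_neg, mul_comm n, pow_mul, ← mul_pow]
  exact pow_le_pow_left₀ (by positivity) hn n

/-- Euler's expansion of `(y; t²)_∞`. -/
theorem hasSum_euler {t : ℂ} (ht : ‖t‖ < 1) (y : ℂ) :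
    HasSum (fun n : ℕ => t ^ (n * (n - 1)) * (-y) ^ n / qPoch (t ^ 2) (t ^ 2) n)
      (qPochInf y (t ^ 2)) := by
  have ht2 := norm_pow_lt_one ht two_ne_zero
  have hsum := fun y => (summable_euler ht y).of_norm
  set E : ℂ → ℂ := fun y => ∑' n : ℕ, t ^ (n * (n - 1)) * (-y) ^ n / qPoch (t ^ 2) (t ^ 2) n
    with hE
  -- The product satisfies the same functional equation; iterating it and using `E → 1` at the
  -- origin identifies the two.
  have hfun : ∀ y, E y = (1 - y) * E (y * t ^ 2) := by
    intro y
    have h1 : E y - E (y * t ^ 2) = -y * E (y * t ^ 2) := by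
      rw [hE, ← (hsum y).tsum_sub (hsum _), ((hsum y).sub (hsum _)).tsum_eq_zero_add,
        ← tsum_mul_left]
      simp only [pow_zero, sub_self, zero_add]
      refine tsum_congr fun n => ?_
      have hn := qPoch_ne_zero ht2 ht2 n
      have hn1 := qPoch_ne_zero ht2 ht2 (n + 1)
      have hn2 : 1 - t ^ 2 * (t ^ 2) ^ n ≠ 0 := sub_ne_zero.2 (mul_pow_ne_one ht2 ht2 n).symm
      have he : t ^ ((n + 1) * (n + 1 - 1)) = t ^ (n * (n - 1)) * (t ^ 2) ^ n := by
        rw [← pow_mul, ← pow_add]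
        congr 1
        cases n with
        | zero => rfl
        | succ k => simp; ring
      rw [qPoch_succ, he]
      field_simp
      ring
    linear_combination h1
  have hiter : ∀ N, E y = qPoch y (t ^ 2) N * E (y * (t ^ 2) ^ N) := by
    intro N
    induction N with
    | zero => simp [qPoch_zero]
    | succ N ih =>
      rw [ih, hfun, qPoch_succ, pow_succ (t ^ 2)]
      ring_nf
  have hlim : Tendsto (fun N : ℕ => E (y * (t ^ 2) ^ N)) atTop (𝓝 1) := by
    have hval : ∑' n : ℕ, (if n = 0 then (1 : ℂ) else 0) = 1 := by simp
    rw [← hval]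
    refine tendsto_tsum_of_dominated_convergence (summable_euler ht y) (fun n => ?_)
      (Eventually.of_forall fun N n => ?_)
    · rcases eq_or_ne n 0 with rfl | hn
      · simp [qPoch_zero]
      · rw [if_neg hn]
        have h0 : Tendsto (fun N : ℕ => -(y * (t ^ 2) ^ N)) atTop (𝓝 0) := by
          simpa using ((tendsto_pow_atTop_nhds_zero_of_norm_lt_one ht2).const_mul y).neg
        simpa [hn] using ((h0.pow n).const_mul (t ^ (n * (n - 1)))).div_const
          (qPoch (t ^ 2) (t ^ 2) n)
    · simp only [norm_div, norm_mul, norm_pow, norm_neg]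
      gcongr
      exact mul_le_of_le_one_right (norm_nonneg y)
        (pow_le_one₀ (by positivity) (pow_le_one₀ (norm_nonneg t) ht.le))
  have : E y = qPochInf y (t ^ 2) := by
    have h3 := (tendsto_qPoch y ht2).mul hlim
    rw [mul_one] at h3
    exact tendsto_nhds_unique (tendsto_const_nhds.congr hiter) h3
  rw [← this]
  exact (hsum y).hasSum

/-! ### Gaussian binomials with an integer lower index. -/

/-- `1 / (p; p)_k` for an integer `k`, which vanishes for negative `k`. -/
noncomputable def invQPoch (p : ℂ) (k : ℤ) : ℂ :=
  if k < 0 then 0 else (qPoch p p k.toNat)⁻¹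

theorem invQPoch_natCast (p : ℂ) (n : ℕ) : invQPoch p n = (qPoch p p n)⁻¹ := by
  simp [invQPoch]

theorem invQPoch_of_neg (p : ℂ) {k : ℤ} (hk : k < 0) : invQPoch p k = 0 := by
  simp [invQPoch, hk]

/-- Extension by zero is consistent with the recurrence because the factor `1 - p^0` vanishes at `k
= 0`. Hence both Pascal rules hold for every integer `k`, with no boundary cases. -/
theorem one_sub_zpow_mul_invQPoch {p : ℂ} (hp : ‖p‖ < 1) (k : ℤ) :
    (1 - p ^ k) * invQPoch p k = invQPoch p (k - 1) := by
  rcases lt_trichotomy k 0 with hk | rfl | hk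
  · rw [invQPoch_of_neg p hk, invQPoch_of_neg p (by lia), mul_zero]
  · simp [invQPoch_of_neg]
  · obtain ⟨n, rfl⟩ : ∃ n : ℕ, k = (n + 1 : ℕ) := ⟨(k - 1).toNat, by lia⟩
    rw [show (((n + 1 : ℕ) : ℤ) - 1) = (n : ℤ) by lia, invQPoch_natCast, invQPoch_natCast,
      zpow_natCast, qPoch_succ]
    have h1 := qPoch_ne_zero hp hp n
    have h2 : 1 - p * p ^ n ≠ 0 := sub_ne_zero.2 (mul_pow_ne_one hp hp n).symm
    rw [pow_succ']
    field_simp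

/-- The Gaussian binomial coefficient with an integer lower index. -/
noncomputable def qBinom (p : ℂ) (N : ℕ) (k : ℤ) : ℂ :=
  qPoch p p N * (invQPoch p k * invQPoch p (N - k))

theorem qBinom_symm (p : ℂ) (N : ℕ) (k : ℤ) : qBinom p N (N - k) = qBinom p N k := by
  rw [qBinom, qBinom, sub_sub_cancel]; ring

theorem qBinom_congr (p : ℂ) (N : ℕ) {k l : ℤ} (h : k + l = N) : qBinom p N k = qBinom p N l := by
  rw [← qBinom_symm, ← h, add_sub_cancel_left]

theorem qBinom_zero_zero (p : ℂ) : qBinom p 0 0 = 1 := by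
  simp [qBinom, invQPoch, qPoch_zero]

theorem qBinom_eq_zero (p : ℂ) (N : ℕ) {k : ℤ} (h : k < 0 ∨ N < k) : qBinom p N k = 0 := by
  rcases h with h | h
  · rw [qBinom, invQPoch_of_neg p h]; ring
  · rw [qBinom, invQPoch_of_neg p (k := N - k) (by lia)]; ring

theorem qBinom_succ {p : ℂ} (hp0 : p ≠ 0) (hp : ‖p‖ < 1) (N : ℕ) (k : ℤ) :
    qBinom p (N + 1) k = qBinom p N (k - 1) + p ^ k * qBinom p N k := by
  have h1 := one_sub_zpow_mul_invQPoch hp k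
  have h2 := one_sub_zpow_mul_invQPoch hp ((N + 1 : ℕ) - k)
  have h3 : p ^ k * p ^ (((N + 1 : ℕ) : ℤ) - k) = p * p ^ N := by
    rw [← zpow_add₀ hp0, add_sub_cancel, zpow_natCast, pow_succ']
  simp only [qBinom, qPoch_succ]
  rw [show ((N : ℤ) - (k - 1)) = (N + 1 : ℕ) - k by push_cast; ring,
    show ((N : ℤ) - k) = (N + 1 : ℕ) - k - 1 by push_cast; ring, ← h1, ← h2, ← h3]
  ring

theorem qBinom_succ' {p : ℂ} (hp0 : p ≠ 0) (hp : ‖p‖ < 1) (N : ℕ) (k : ℤ) :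
    qBinom p (N + 1) k = qBinom p N k + p ^ (N + 1 - k) * qBinom p N (k - 1) := by
  rw [← qBinom_symm, qBinom_succ hp0 hp,
    qBinom_congr p N (k := (N + 1 : ℕ) - k - 1) (l := k) (by push_cast; ring),
    qBinom_congr p N (k := (N + 1 : ℕ) - k) (l := k - 1) (by push_cast; ring)]
  push_cast
  rfl

/-- The binomial has finite support, so these bilateral sums are finite, whatever the weight. -/
theorem summable_mul_qBinom (p : ℂ) (N : ℕ) (w : ℤ → ℂ) (c : ℤ) {d : ℤ} (hd : 1 ≤ d) :
    Summable fun j => w j * qBinom p N (c + d * j) := by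
  refine summable_of_ne_finset_zero (s := Icc (-(N + |c|)) (N + |c|)) fun j hj => ?_
  rw [qBinom_eq_zero, mul_zero]
  by_contra! h
  obtain ⟨h1, h2⟩ := h
  refine hj (mem_Icc.2 ⟨?_, ?_⟩)
  · have := le_abs_self c
    by_contra! h3
    have : (N : ℤ) + |c| ≥ 0 := by positivity
    nlinarith
  · have := neg_abs_le c
    by_contra! h3
    have : (N : ℤ) + |c| ≥ 0 := by positivity
    nlinarith

/-! ### Expansions of `1`, `p^m` and `1 - p^{2m}` in Gaussian binomials. -/

theorem tsum_eq_of_reflect {F G h : ℤ → ℂ} (c : ℤ) (hG : Summable G) (hh : Summable h)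
    (H : ∀ j, F j = G j + (h j - h (c - j))) : ∑' j, F j = ∑' j, G j := by
  have hh' : Summable fun j => h (c - j) := (Equiv.subLeft c).summable_iff.2 hh
  have h2 : ∑' j, h (c - j) = ∑' j, h j := (Equiv.subLeft c).tsum_eq h
  rw [tsum_congr H, hG.tsum_add (hh.sub hh'), hh.tsum_sub hh', h2, sub_self, add_zero]

section identities

variable {p : ℂ} (hp0 : p ≠ 0) (hp : ‖p‖ < 1)
include hp0 hp

/-- Pascal's rule applied to both binomials leaves remainders `h j` and `-h (-j)`, by the symmetry
of the binomials of top index `2m + 1`; they cancel in the sum. -/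
theorem qBinom_odd_step (m : ℕ) :
    ∑' j : ℤ, (p ^ (6 * j ^ 2 + j) * qBinom p (2 * m + 2) (m + 1 + 3 * j)
      - p ^ (6 * j ^ 2 + 5 * j + 1) * qBinom p (2 * m + 2) (m + 2 + 3 * j)) =
    ∑' j : ℤ, (p ^ (6 * j ^ 2 + j) * qBinom p (2 * m + 1) (m + 1 + 3 * j)
      - p ^ (6 * j ^ 2 + 5 * j + 1) * qBinom p (2 * m + 1) (m + 2 + 3 * j)) := by
  refine tsum_eq_of_reflect (h := fun j => p ^ (6 * j ^ 2 - 2 * j + m + 1) *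
    qBinom p (2 * m + 1) (m + 3 * j)) 0
    ((summable_mul_qBinom p _ _ _ (by norm_num)).sub (summable_mul_qBinom p _ _ _ (by norm_num)))
    (summable_mul_qBinom p _ _ _ (by norm_num)) fun j => ?_
  rw [qBinom_succ' hp0 hp _ (m + 1 + 3 * j), qBinom_succ' hp0 hp _ (m + 2 + 3 * j),
    qBinom_congr p (2 * m + 1) (k := m + 3 * (0 - j)) (l := m + 1 + 3 * j) (by push_cast; ring),
    mul_add, mul_add, ← mul_assoc, ← mul_assoc, ← zpow_add₀ hp0, ← zpow_add₀ hp0]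
  push_cast
  rw [show 6 * j ^ 2 + j + (2 * (m : ℤ) + 1 + 1 - (m + 1 + 3 * j)) = 6 * j ^ 2 - 2 * j + m + 1 by ring,
    show 6 * j ^ 2 + 5 * j + 1 + (2 * (m : ℤ) + 1 + 1 - (m + 2 + 3 * j))
      = 6 * (0 - j) ^ 2 - 2 * (0 - j) + m + 1 by ring,
    show (m : ℤ) + 1 + 3 * j - 1 = m + 3 * j by ring,
    show (m : ℤ) + 2 + 3 * j - 1 = m + 1 + 3 * j by ring]
  ring

/-- Here the other Pascal rule is the one whose remainders match, and the reflection is `j ↦ -1 -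
j`. -/
theorem qBinom_even_step (m : ℕ) :
    ∑' j : ℤ, (p ^ (6 * j ^ 2 + j) * qBinom p (2 * m + 1) (m + 1 + 3 * j)
      - p ^ (6 * j ^ 2 + 5 * j + 1) * qBinom p (2 * m + 1) (m + 2 + 3 * j)) =
    ∑' j : ℤ, (p ^ (6 * j ^ 2 + j) * qBinom p (2 * m) (m + 3 * j)
      - p ^ (6 * j ^ 2 + 5 * j + 1) * qBinom p (2 * m) (m + 1 + 3 * j)) := by
  refine tsum_eq_of_reflect (h := fun j => p ^ (6 * j ^ 2 + 4 * j + m + 1) *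
    qBinom p (2 * m) (m + 1 + 3 * j)) (-1)
    ((summable_mul_qBinom p _ _ _ (by norm_num)).sub (summable_mul_qBinom p _ _ _ (by norm_num)))
    (summable_mul_qBinom p _ _ _ (by norm_num)) fun j => ?_
  rw [qBinom_succ hp0 hp _ (m + 1 + 3 * j), qBinom_succ hp0 hp _ (m + 2 + 3 * j),
    qBinom_congr p (2 * m) (k := m + 1 + 3 * (-1 - j)) (l := m + 2 + 3 * j) (by push_cast; ring),
    mul_add, mul_add, ← mul_assoc, ← mul_assoc, ← zpow_add₀ hp0, ← zpow_add₀ hp0]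
  rw [show 6 * j ^ 2 + j + ((m : ℤ) + 1 + 3 * j) = 6 * j ^ 2 + 4 * j + m + 1 by ring,
    show 6 * j ^ 2 + 5 * j + 1 + ((m : ℤ) + 2 + 3 * j)
      = 6 * (-1 - j) ^ 2 + 4 * (-1 - j) + m + 1 by ring,
    show (m : ℤ) + 1 + 3 * j - 1 = m + 3 * j by ring,
    show (m : ℤ) + 2 + 3 * j - 1 = m + 1 + 3 * j by ring]
  ring

theorem tsum_qBinom_even (m : ℕ) :
    ∑' j : ℤ, (p ^ (6 * j ^ 2 + j) * qBinom p (2 * m) (m + 3 * j)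
      - p ^ (6 * j ^ 2 + 5 * j + 1) * qBinom p (2 * m) (m + 1 + 3 * j)) = 1 := by
  induction m with
  | zero =>
    rw [tsum_eq_single 0 fun j hj => ?_]
    · simp [qBinom_zero_zero, qBinom_eq_zero]
    · rw [qBinom_eq_zero, qBinom_eq_zero]
      · ring
      all_goals push_cast; lia
  | succ m ih =>
    refine Eq.trans (tsum_congr fun j => ?_)
      ((qBinom_odd_step hp0 hp m).trans ((qBinom_even_step hp0 hp m).trans ih))
    push_cast
    rw [show (m : ℤ) + 1 + 1 + 3 * j = m + 2 + 3 * j by ring]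
    rfl

theorem tsum_qBinom_odd (m : ℕ) :
    ∑' j : ℤ, (p ^ (6 * j ^ 2 + j) * qBinom p (2 * m + 1) (m + 1 + 3 * j)
      - p ^ (6 * j ^ 2 + 5 * j + 1) * qBinom p (2 * m + 1) (m + 2 + 3 * j)) = 1 := by
  rw [qBinom_even_step hp0 hp, tsum_qBinom_even hp0 hp]

/-- The expansion of `p^m`. -/
theorem tsum_qBinom_pow (m : ℕ) :
    ∑' j : ℤ, (p ^ (6 * j ^ 2 + 2 * j) * qBinom p (2 * m) (m + 3 * j)
      - p ^ (6 * j ^ 2 + 2 * j) * qBinom p (2 * m) (m + 1 + 3 * j)) = p ^ m := by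
  cases m with
  | zero =>
    rw [tsum_eq_single 0 fun j hj => ?_]
    · simp [qBinom_zero_zero, qBinom_eq_zero]
    · rw [qBinom_eq_zero, qBinom_eq_zero]
      · ring
      all_goals push_cast; lia
  | succ m =>
    conv_rhs => rw [← mul_one (p ^ (m + 1)), ← tsum_qBinom_odd hp0 hp m, ← tsum_mul_left]
    refine tsum_eq_of_reflect (h := fun j => p ^ (6 * j ^ 2 - j + m + 1) *
      qBinom p (2 * m + 1) (m + 3 * j)) 0
      (((summable_mul_qBinom p _ _ _ (by norm_num)).sub
        (summable_mul_qBinom p _ _ _ (by norm_num))).mul_left _)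
      (summable_mul_qBinom p _ _ _ (by norm_num)) fun j => ?_
    -- One Pascal rule is used on each binomial, so that their common term cancels. What is left is
    -- `p^(m+1)` times the summand of `tsum_qBinom_odd`, up to the reflection `j ↦ -j`.
    rw [show 2 * (m + 1) = 2 * m + 1 + 1 by ring, qBinom_succ' hp0 hp _ (_ + 3 * j),
      qBinom_succ hp0 hp _ (_ + 1 + 3 * j),
      qBinom_congr p (2 * m + 1) (k := m + 3 * (0 - j)) (l := m + 1 + 3 * j) (by push_cast; ring),
      mul_add, mul_add, ← mul_assoc, ← mul_assoc, mul_sub, ← mul_assoc, ← mul_assoc,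
      ← zpow_natCast p, ← zpow_add₀ hp0, ← zpow_add₀ hp0, ← zpow_add₀ hp0, ← zpow_add₀ hp0]
    push_cast
    rw [show 6 * j ^ 2 + 2 * j + (2 * (m : ℤ) + 1 + 1 - (m + 1 + 3 * j))
        = 6 * j ^ 2 - j + m + 1 by ring,
      show 6 * j ^ 2 + 2 * j + ((m : ℤ) + 1 + 1 + 3 * j) = m + 1 + (6 * j ^ 2 + 5 * j + 1) by ring,
      show (m : ℤ) + 1 + (6 * j ^ 2 + j) = 6 * (0 - j) ^ 2 - (0 - j) + m + 1 by ring,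
      show (m : ℤ) + 1 + 3 * j - 1 = m + 3 * j by ring,
      show (m : ℤ) + 1 + 1 + 3 * j - 1 = m + 1 + 3 * j by ring,
      show (m : ℤ) + 1 + 1 + 3 * j = m + 2 + 3 * j by ring]
    ring

/-- Same cancellation as for `tsum_qBinom_pow`, descending to `tsum_qBinom_even`. It serves the
expansion of `1 - p^{2m}`. -/
theorem tsum_qBinom_odd_pow (m : ℕ) :
    ∑' j : ℤ, (p ^ (6 * j ^ 2 + 4 * j + 1) * qBinom p (2 * m + 1) (m + 1 + 3 * j)
      - p ^ (6 * j ^ 2 + 4 * j + 1) * qBinom p (2 * m + 1) (m + 2 + 3 * j)) = p ^ (m + 1) := by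
  conv_rhs => rw [← mul_one (p ^ (m + 1)), ← tsum_qBinom_even hp0 hp m, ← tsum_mul_left]
  refine tsum_eq_of_reflect (h := fun j => p ^ (6 * j ^ 2 + 5 * j + m + 2) *
    qBinom p (2 * m) (m + 1 + 3 * j)) (-1)
    (((summable_mul_qBinom p _ _ _ (by norm_num)).sub
      (summable_mul_qBinom p _ _ _ (by norm_num))).mul_left _)
    (summable_mul_qBinom p _ _ _ (by norm_num)) fun j => ?_
  rw [qBinom_succ' hp0 hp _ (m + 1 + 3 * j), qBinom_succ hp0 hp _ (m + 2 + 3 * j),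
    qBinom_congr p (2 * m) (k := m + 1 + 3 * (-1 - j)) (l := m + 2 + 3 * j) (by push_cast; ring),
    mul_add, mul_add, ← mul_assoc, ← mul_assoc, mul_sub, ← mul_assoc, ← mul_assoc,
    ← zpow_natCast p, ← zpow_add₀ hp0, ← zpow_add₀ hp0, ← zpow_add₀ hp0, ← zpow_add₀ hp0]
  push_cast
  rw [show 6 * j ^ 2 + 4 * j + 1 + (2 * (m : ℤ) + 1 - (m + 1 + 3 * j))
      = m + 1 + (6 * j ^ 2 + j) by ring,
    show 6 * j ^ 2 + 4 * j + 1 + ((m : ℤ) + 2 + 3 * j)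
      = 6 * (-1 - j) ^ 2 + 5 * (-1 - j) + m + 2 by ring,
    show (m : ℤ) + 1 + (6 * j ^ 2 + 5 * j + 1) = 6 * j ^ 2 + 5 * j + m + 2 by ring,
    show (m : ℤ) + 1 + 3 * j - 1 = m + 3 * j by ring,
    show (m : ℤ) + 2 + 3 * j - 1 = m + 1 + 3 * j by ring]
  ring

/-- The expansion of `1 - p^{2m}`. -/
theorem tsum_qBinom_one_sub (m : ℕ) :
    ∑' j : ℤ, (p ^ (6 * j ^ 2 + j) * qBinom p (2 * m) (m + 1 + 3 * j)
      - p ^ (6 * j ^ 2 + 7 * j + 2) * qBinom p (2 * m) (m + 1 + 3 * j)) = 1 - p ^ (2 * m) := by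
  cases m with
  | zero =>
    refine (tsum_congr fun j => ?_).trans (tsum_zero.trans (by simp))
    rw [qBinom_eq_zero]
    · ring
    · push_cast; lia
  | succ m =>
    -- The `1` and one of the two factors `p^(m+1)` are replaced by their expansions of top index
    -- `2m + 1`.
    have h1 : 1 - p ^ (2 * (m + 1)) = 1 - p ^ (m + 1) * p ^ (m + 1) := by ring
    have hs1 := ((summable_mul_qBinom p (2 * m + 1) (fun j => p ^ (6 * j ^ 2 + j)) (m + 1)
      (by norm_num : (1 : ℤ) ≤ 3)).sub
      (summable_mul_qBinom p (2 * m + 1) (fun j => p ^ (6 * j ^ 2 + 5 * j + 1)) (m + 2)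
      (by norm_num : (1 : ℤ) ≤ 3)))
    have hs2 := ((summable_mul_qBinom p (2 * m + 1) (fun j => p ^ (6 * j ^ 2 + 4 * j + 1)) (m + 1)
      (by norm_num : (1 : ℤ) ≤ 3)).sub
      (summable_mul_qBinom p (2 * m + 1) (fun j => p ^ (6 * j ^ 2 + 4 * j + 1)) (m + 2)
      (by norm_num : (1 : ℤ) ≤ 3))).mul_left (p ^ (m + 1))
    rw [h1]
    nth_rw 2 [← tsum_qBinom_odd_pow hp0 hp m]
    rw [← tsum_qBinom_odd hp0 hp m, ← tsum_mul_left, ← hs1.tsum_sub hs2]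
    refine tsum_eq_of_reflect (h := fun j => p ^ (6 * j ^ 2 + 5 * j + 1) *
      qBinom p (2 * m + 1) (m + 2 + 3 * j)) (-1) (hs1.sub hs2)
      (summable_mul_qBinom p _ _ _ (by norm_num)) fun j => ?_
    rw [mul_sub]
    simp only [← mul_assoc, ← sub_mul]
    rw [show 2 * (m + 1) = 2 * m + 1 + 1 by ring,
      qBinom_congr p (2 * m + 1) (k := m + 2 + 3 * (-1 - j)) (l := m + 2 + 3 * j)
        (by push_cast; ring),
      sub_mul]
    refine (congrArg₂ (· - ·) (congrArg _ (qBinom_succ hp0 hp _ _))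
      (congrArg _ (qBinom_succ' hp0 hp _ _))).trans ?_
    rw [mul_add, mul_add, ← mul_assoc, ← mul_assoc,
      ← zpow_natCast p, ← zpow_add₀ hp0, ← zpow_add₀ hp0, ← zpow_add₀ hp0]
    push_cast
    rw [show 6 * j ^ 2 + j + ((m : ℤ) + 1 + 1 + 3 * j)
        = m + 1 + (6 * j ^ 2 + 4 * j + 1) by ring,
      show 6 * j ^ 2 + 7 * j + 2 + (2 * (m : ℤ) + 1 + 1 - (m + 1 + 1 + 3 * j))
        = m + 1 + (6 * j ^ 2 + 4 * j + 1) by ring,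
      show 6 * (-1 - j) ^ 2 + 5 * (-1 - j) + 1 = 6 * j ^ 2 + 7 * j + 2 by ring,
      show (m : ℤ) + 1 + 1 + 3 * j - 1 = m + 1 + 3 * j by ring,
      show (m : ℤ) + 1 + 1 + 3 * j = m + 2 + 3 * j by ring]
    ring

end identities

/-! ### The `₁φ₁` summation and Bailey's transformation. -/

theorem HasSum.of_eq {ι : Type*} {f g : ι → ℂ} {a b : ℂ} (h : HasSum f a) (hf : ∀ x, g x = f x)
    (hab : b = a) : HasSum g b := by
  rw [hab, funext hf]; exact h

theorem tsum_prod_eq_tsum_antidiagonal {f : ℕ × ℕ → ℂ} (hf : Summable f) :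
    ∑' x, f x = ∑' n, ∑ x ∈ antidiagonal n, f x := by
  have h := (HasAntidiagonal.sigmaAntidiagonalEquivProd (A := ℕ)).summable_iff.2 hf
  rw [← (HasAntidiagonal.sigmaAntidiagonalEquivProd (A := ℕ)).tsum_eq f]
  refine h.tsum_sigma.trans ?_
  refine tsum_congr fun n => ?_
  rw [tsum_fintype, ← sum_coe_sort (antidiagonal n) f]
  rfl

/-- This is the coefficient of `x^N` in `((ax; p)_∞ / (x; p)_∞) · (1 / (ax; p)_∞) = 1 / (x; p)_∞`.
The induction avoids the infinite products by splitting `1 - p^(i+j) = (1 - p^i) + p^i (1 - p^j)`.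
-/
theorem sum_antidiagonal_qPoch {p : ℂ} (hp : ‖p‖ < 1) (a : ℂ) (N : ℕ) :
    ∑ x ∈ antidiagonal N, qPoch a p x.1 * a ^ x.2 / (qPoch p p x.1 * qPoch p p x.2) =
      (qPoch p p N)⁻¹ := by
  induction N with
  | zero => simp [qPoch_zero]
  | succ N ih =>
    have hne := fun n : ℕ => qPoch_ne_zero hp hp n
    have hne' : ∀ n : ℕ, 1 - p * p ^ n ≠ 0 := fun n =>
      sub_ne_zero.2 (mul_pow_ne_one hp hp n).symm
    set F : ℕ × ℕ → ℂ := fun x => qPoch a p x.1 * a ^ x.2 / (qPoch p p x.1 * qPoch p p x.2) with hF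
    have h1 : ∑ x ∈ antidiagonal (N + 1), (1 - p ^ x.1) * F x =
        ∑ x ∈ antidiagonal N, (1 - a * p ^ x.1) * F x := by
      rw [Nat.sum_antidiagonal_succ]
      simp only [pow_zero, sub_self, zero_mul, zero_add]
      refine sum_congr rfl fun x _ => ?_
      simp only [hF, qPoch_succ]
      have := hne x.1; have := hne x.2; have := hne' x.1
      rw [pow_succ']
      field_simp
    have h2 : ∑ x ∈ antidiagonal (N + 1), (p ^ x.1 * (1 - p ^ x.2)) * F x =
        ∑ x ∈ antidiagonal N, (a * p ^ x.1) * F x := by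
      rw [Nat.sum_antidiagonal_succ']
      simp only [pow_zero, sub_self, zero_mul, mul_zero, zero_add]
      refine sum_congr rfl fun x _ => ?_
      simp only [hF, qPoch_succ]
      have := hne x.1; have := hne x.2; have := hne' x.2
      rw [pow_succ', pow_succ']
      field_simp
    have h3 : (1 - p * p ^ N) * ∑ x ∈ antidiagonal (N + 1), F x = ∑ x ∈ antidiagonal N, F x := by
      have e1 : ∑ x ∈ antidiagonal N, F x = ∑ x ∈ antidiagonal N, (1 - a * p ^ x.1) * F x +
          ∑ x ∈ antidiagonal N, (a * p ^ x.1) * F x := by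
        rw [← sum_add_distrib]
        exact sum_congr rfl fun x _ => by ring
      rw [e1, ← h1, ← h2, ← sum_add_distrib, mul_sum]
      refine sum_congr rfl fun x hx => ?_
      rw [← pow_succ', ← mem_antidiagonal.1 hx, pow_add]
      ring
    rw [ih] at h3
    rw [qPoch_succ, mul_inv, ← h3]
    field_simp [hne' N]

theorem add_mul_add_sub_one (s u : ℕ) :
    (s + u) * (s + u - 1) = s * (s - 1) + u * (u - 1) + 2 * (s * u) := by
  cases s <;> cases u <;> simp
  · rename_i s u
    rw [show s + 1 + u = s + u + 1 by ring]
    ring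

/-- The summation formula for `₁φ₁`. -/
theorem hasSum_one_phi_one {t : ℂ} (ht : ‖t‖ < 1) (a x : ℂ) :
    HasSum (fun s : ℕ => qPoch a (t ^ 2) s * (t ^ (s * (s - 1)) * (-x) ^ s / qPoch (t ^ 2) (t ^ 2) s)
      * qPochInf (a * x * (t ^ 2) ^ s) (t ^ 2)) (qPochInf x (t ^ 2)) := by
  have ht2 := norm_pow_lt_one ht two_ne_zero
  set e : ℂ → ℕ → ℂ := fun y n => t ^ (n * (n - 1)) * (-y) ^ n / qPoch (t ^ 2) (t ^ 2) n with he
  set f : ℕ × ℕ → ℂ := fun x' => qPoch a (t ^ 2) x'.1 * e x x'.1 * e (a * x * (t ^ 2) ^ x'.1) x'.2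
    with hf
  obtain ⟨C, hC0, hC⟩ := exists_norm_qPoch_le a ht2
  have hsum : Summable f := by
    refine Summable.of_norm_bounded (g := fun x' : ℕ × ℕ => C * (‖e x x'.1‖ * ‖e (a * x) x'.2‖))
      (((summable_euler ht x).mul_of_nonneg (summable_euler ht (a * x)) (fun _ => norm_nonneg _)
        fun _ => norm_nonneg _).mul_left C) fun x' => ?_
    rw [hf, norm_mul, norm_mul, mul_assoc]
    refine mul_le_mul (hC _) ?_ (by positivity) hC0.le
    refine mul_le_mul_of_nonneg_left ?_ (norm_nonneg _)
    simp only [he, norm_div, norm_mul, norm_pow, norm_neg]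
    have : ‖a‖ * ‖x‖ * (‖t‖ ^ 2) ^ x'.1 ≤ ‖a‖ * ‖x‖ := mul_le_of_le_one_right (by positivity)
      (pow_le_one₀ (by positivity) (pow_le_one₀ (norm_nonneg t) ht.le))
    gcongr
  have h1 := hsum.hasSum.prod_fiberwise (fun s => (hasSum_euler ht (a * x * (t ^ 2) ^ s)).mul_left
    (qPoch a (t ^ 2) s * e x s))
  -- The rows of `f` were summed by Euler's expansion. Its antidiagonals are summed by
  -- `sum_antidiagonal_qPoch`, the factor `t^{2su}` coming from `(s+u)(s+u-1)` matching `(t²)^s` in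
  -- the argument.
  have h2 : ∑' x', f x' = qPochInf x (t ^ 2) := by
    rw [tsum_prod_eq_tsum_antidiagonal hsum, ← (hasSum_euler ht x).tsum_eq]
    refine tsum_congr fun n => ?_
    rw [div_eq_mul_inv, ← sum_antidiagonal_qPoch ht2 a n, mul_sum]
    refine sum_congr rfl fun y hy => ?_
    have h3 : (-(a * x * (t ^ 2) ^ y.1)) ^ y.2 = (-x) ^ y.2 * a ^ y.2 * t ^ (2 * (y.1 * y.2)) := by
      rw [← pow_mul, show -(a * x * t ^ (2 * y.1)) = -x * a * t ^ (2 * y.1) by ring, mul_pow,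
        mul_pow, ← pow_mul, mul_assoc 2]
    simp only [hf, he]
    rw [← mem_antidiagonal.1 hy, add_mul_add_sub_one, h3, pow_add _ (_ + _), pow_add, pow_add]
    ring
  rw [← h2]
  exact h1

/-- Terms with `m < k` vanish, and `m = r + k` gives the `₁φ₁` sum at `a = x = -s^(1+2k)`. Then `ax
= s^(2+4k)`, so the tail `(ax s^{2r}; s²)_∞` is `(s²; s²)_∞ / (s²; s²)_{r+2k}`. -/
theorem hasSum_bailey_nat {s : ℂ} (hs : ‖s‖ < 1) (k : ℕ) :
    HasSum (fun m : ℕ => s ^ m ^ 2 * qPoch (-s) (s ^ 2) m *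
      (invQPoch (s ^ 2) (m - k) * invQPoch (s ^ 2) (m + k)))
      (s ^ k ^ 2 * (qPochInf (-s) (s ^ 2) / qPochInf (s ^ 2) (s ^ 2))) := by
  have hp := norm_pow_lt_one hs two_ne_zero
  rw [← (add_left_injective k).hasSum_iff]
  · have h := (hasSum_one_phi_one hs (-s ^ (1 + 2 * k)) (-s ^ (1 + 2 * k))).mul_left
      (s ^ k ^ 2 * qPoch (-s) (s ^ 2) k / qPochInf (s ^ 2) (s ^ 2))
    have e1 : qPochInf (-s) (s ^ 2) = qPoch (-s) (s ^ 2) k * qPochInf (-s ^ (1 + 2 * k)) (s ^ 2) := by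
      rw [qPochInf_eq_mul (-s) hp k]
      congr 2
      ring
    rw [e1]
    refine h.of_eq (fun r => ?_) (by ring)
    · have e2 : qPochInf (s ^ 2) (s ^ 2) = qPoch (s ^ 2) (s ^ 2) (r + 2 * k) *
          qPochInf (-s ^ (1 + 2 * k) * -s ^ (1 + 2 * k) * (s ^ 2) ^ r) (s ^ 2) := by
        rw [qPochInf_eq_mul (s ^ 2) hp (r + 2 * k)]
        congr 2
        ring
      have e3 : qPochInf (-s ^ (1 + 2 * k) * -s ^ (1 + 2 * k) * (s ^ 2) ^ r) (s ^ 2) ≠ 0 := by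
        intro h0
        rw [h0, mul_zero] at e2
        exact qPochInf_ne_zero_of_norm_lt hp hp e2
      have e4 : qPoch (-s) (s ^ 2) (r + k) =
          qPoch (-s) (s ^ 2) k * qPoch (-s ^ (1 + 2 * k)) (s ^ 2) r := by
        rw [add_comm, qPoch_add]
        congr 2
        ring
      have e5 : s ^ (r + k) ^ 2 = s ^ k ^ 2 * (s ^ (r * (r - 1)) * (s ^ (1 + 2 * k)) ^ r) := by
        rw [← pow_mul, ← pow_add, ← pow_add]
        congr 1
        cases r with
        | zero => simp
        | succ r => simp; ring
      simp only [Function.comp]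
      rw [show ((r + k : ℕ) : ℤ) - k = (r : ℕ) by push_cast; ring,
        show ((r + k : ℕ) : ℤ) + k = (r + 2 * k : ℕ) by push_cast; ring,
        invQPoch_natCast, invQPoch_natCast, e2, e4, e5, neg_neg]
      generalize qPochInf (-s ^ (1 + 2 * k) * -s ^ (1 + 2 * k) * (s ^ 2) ^ r) (s ^ 2) = Y at e3 ⊢
      have := qPoch_ne_zero hp hp r
      have := qPoch_ne_zero hp hp (r + 2 * k)
      field_simp
  · intro m hm
    have : m < k := by
      by_contra! h
      exact hm ⟨m - k, by simp; lia⟩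
    rw [invQPoch_of_neg _ (k := (m : ℤ) - k) (by lia)]
    ring

theorem hasSum_bailey {s : ℂ} (hs : ‖s‖ < 1) (k : ℤ) :
    HasSum (fun m : ℕ => s ^ m ^ 2 * qPoch (-s) (s ^ 2) m *
      (invQPoch (s ^ 2) (m - k) * invQPoch (s ^ 2) (m + k)))
      (s ^ (k ^ 2) * (qPochInf (-s) (s ^ 2) / qPochInf (s ^ 2) (s ^ 2))) := by
  obtain ⟨n, rfl | rfl⟩ := k.eq_nat_or_neg
  · exact_mod_cast hasSum_bailey_nat hs n
  · refine (hasSum_bailey_nat hs n).of_eq (fun m => ?_) ?_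
    · rw [sub_neg_eq_add, ← sub_eq_add_neg]; ring
    · rw [neg_sq]
      norm_cast

theorem exists_norm_invQPoch_le {p : ℂ} (hp : ‖p‖ < 1) :
    ∃ C, 0 < C ∧ ∀ k, ‖invQPoch p k‖ ≤ C := by
  obtain ⟨C, hC0, hC⟩ := exists_norm_inv_qPoch_le hp hp
  refine ⟨C, hC0, fun k => ?_⟩
  rw [invQPoch]
  split_ifs
  · simpa using hC0.le
  · exact hC _

theorem summable_norm_pow_sq {s : ℂ} (hs : ‖s‖ < 1) : Summable fun m : ℕ => ‖s ^ m ^ 2‖ := by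
  refine Summable.of_nonneg_of_le (fun _ => norm_nonneg _) (fun m => ?_)
    (summable_geometric_of_lt_one (norm_nonneg s) hs)
  rw [norm_pow]
  exact pow_le_pow_of_le_one (norm_nonneg s) hs.le (by nlinarith)

/-- Bailey's transformation, for a series expanded in the `invQPoch (m - κ) * invQPoch (m + κ)`. -/
theorem hasSum_bailey_transform {s : ℂ} (hs : ‖s‖ < 1) {w : ℤ → ℂ} (κ : ℤ → ℤ)
    (hw : Summable fun j => ‖w j‖) :
    HasSum (fun m : ℕ => s ^ m ^ 2 * qPoch (-s) (s ^ 2) m *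
      ∑' j, w j * (invQPoch (s ^ 2) (m - κ j) * invQPoch (s ^ 2) (m + κ j)))
      (qPochInf (-s) (s ^ 2) / qPochInf (s ^ 2) (s ^ 2) * ∑' j, w j * s ^ (κ j ^ 2)) := by
  have hp := norm_pow_lt_one hs two_ne_zero
  obtain ⟨C, hC0, hC⟩ := exists_norm_qPoch_le (-s) hp
  obtain ⟨D, hD0, hD⟩ := exists_norm_invQPoch_le hp
  set f : ℕ × ℤ → ℂ := fun x => s ^ x.1 ^ 2 * qPoch (-s) (s ^ 2) x.1 *
    (w x.2 * (invQPoch (s ^ 2) (x.1 - κ x.2) * invQPoch (s ^ 2) (x.1 + κ x.2))) with hf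
  have hsum : Summable f := by
    refine Summable.of_norm_bounded (g := fun x : ℕ × ℤ => (C * D * D) * (‖s ^ x.1 ^ 2‖ * ‖w x.2‖))
      (((summable_norm_pow_sq hs).mul_of_nonneg hw (fun _ => norm_nonneg _)
        fun _ => norm_nonneg _).mul_left _) fun x => ?_
    simp only [hf, norm_mul]
    calc _ ≤ ‖s ^ x.1 ^ 2‖ * C * (‖w x.2‖ * (D * D)) := by
          gcongr
          · exact hC _
          · exact hD _
          · exact hD _
      _ = _ := by ring
  have h1 : HasSum (fun m : ℕ => s ^ m ^ 2 * qPoch (-s) (s ^ 2) m *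
      ∑' j, w j * (invQPoch (s ^ 2) (m - κ j) * invQPoch (s ^ 2) (m + κ j))) (∑' x, f x) := by
    refine (hsum.hasSum.prod_fiberwise fun m => (hsum.prod_factor m).hasSum).of_eq
      (fun m => ?_) rfl
    rw [← tsum_mul_left]
  have h2 := ((Equiv.prodComm ℤ ℕ).summable_iff.2 hsum)
  have h3 : ∑' x, f x = ∑' j : ℤ, ∑' m : ℕ, f (m, j) := by
    rw [← (Equiv.prodComm ℤ ℕ).tsum_eq f]
    exact h2.tsum_prod
  rw [h3] at h1
  refine h1.of_eq (fun _ => rfl) ?_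
  rw [← tsum_mul_left]
  refine tsum_congr fun j => ?_
  have h4 := ((hasSum_bailey hs (κ j)).mul_left (w j)).tsum_eq
  rw [show qPochInf (-s) (s ^ 2) / qPochInf (s ^ 2) (s ^ 2) * (w j * s ^ (κ j ^ 2)) =
    w j * (s ^ (κ j ^ 2) * (qPochInf (-s) (s ^ 2) / qPochInf (s ^ 2) (s ^ 2))) by ring, ← h4]
  refine tsum_congr fun m => ?_
  simp only [hf]
  ring

theorem summable_norm_zpow {z : ℂ} (hz0 : z ≠ 0) (hz : ‖z‖ < 1) {Q : ℤ → ℤ} (hQ : ∀ j, |j| ≤ Q j) :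
    Summable fun j : ℤ => ‖z ^ Q j‖ := by
  have h : Summable fun j : ℤ => ‖z‖ ^ |j| := by
    have h1 := summable_geometric_of_lt_one (norm_nonneg z) hz
    refine Summable.of_nat_of_neg ?_ ?_ <;> simpa using h1
  refine Summable.of_nonneg_of_le (fun _ => norm_nonneg _) (fun j => ?_) h
  rw [norm_zpow]
  exact zpow_le_zpow_right_of_le_one₀ (norm_pos_iff.2 hz0) hz.le (hQ j)

theorem qBinom_two_mul (p : ℂ) (m : ℕ) (k : ℤ) :
    qBinom p (2 * m) (m + k) = qPoch p p (2 * m) * (invQPoch p (m - k) * invQPoch p (m + k)) := by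
  rw [qBinom, mul_comm (invQPoch p (m + k))]
  congr 3
  push_cast; ring

/-- Division by `(s²; s²)_{2m}` turns the binomial of lower index `m + κ` into `1 / ((s²; s²)_{m-κ}
(s²; s²)_{m+κ})`, so `hc` supplies a Bailey pair. The bounds `|j| ≤ Q j` make its weights absolutely
summable. -/
theorem hasSum_of_qBinom_expansion {s : ℂ} (hs0 : s ≠ 0) (hs : ‖s‖ < 1) {Q₁ Q₂ : ℤ → ℤ}
    (κ₁ κ₂ : ℤ → ℤ) (hQ₁ : ∀ j, |j| ≤ Q₁ j) (hQ₂ : ∀ j, |j| ≤ Q₂ j) {c : ℕ → ℂ}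
    (hc : ∀ m : ℕ, ∑' j, ((s ^ 2) ^ Q₁ j * qBinom (s ^ 2) (2 * m) (m + κ₁ j) -
      (s ^ 2) ^ Q₂ j * qBinom (s ^ 2) (2 * m) (m + κ₂ j)) = c m) :
    HasSum (fun m : ℕ => s ^ m ^ 2 * qPoch (-s) (s ^ 2) m * (c m / qPoch (s ^ 2) (s ^ 2) (2 * m)))
      (qPochInf (-s) (s ^ 2) / qPochInf (s ^ 2) (s ^ 2) *
        ∑' j, (s ^ (2 * Q₁ j + κ₁ j ^ 2) - s ^ (2 * Q₂ j + κ₂ j ^ 2))) := by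
  have hp := norm_pow_lt_one hs two_ne_zero
  have hp0 : s ^ 2 ≠ 0 := pow_ne_zero 2 hs0
  have hw₁ := summable_norm_zpow hp0 hp hQ₁
  have hw₂ := summable_norm_zpow hp0 hp hQ₂
  obtain ⟨D, hD0, hD⟩ := exists_norm_invQPoch_le hp
  have hsum : ∀ {Q : ℤ → ℤ} (κ : ℤ → ℤ), (Summable fun j => ‖(s ^ 2) ^ Q j‖) → ∀ m : ℕ,
      Summable fun j => (s ^ 2) ^ Q j *
        (invQPoch (s ^ 2) (m - κ j) * invQPoch (s ^ 2) (m + κ j)) := by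
    intro Q κ h m
    refine Summable.of_norm_bounded (h.mul_right (D * D)) fun j => ?_
    rw [norm_mul, norm_mul]
    gcongr
    · exact hD _
    · exact hD _
  have hsum' : ∀ {Q : ℤ → ℤ} (κ : ℤ → ℤ), (∀ j, |j| ≤ Q j) →
      Summable fun j => s ^ (2 * Q j + κ j ^ 2) := by
    intro Q κ h
    exact (summable_norm_zpow hs0 hs fun j => by nlinarith [h j, abs_nonneg j]).of_norm
  have e : ∀ (Q : ℤ → ℤ) (κ : ℤ → ℤ) j, (s ^ 2) ^ Q j * s ^ (κ j ^ 2) = s ^ (2 * Q j + κ j ^ 2) := by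
    intro Q κ j
    rw [zpow_add₀ hs0, zpow_mul]
    rfl
  refine ((hasSum_bailey_transform hs κ₁ hw₁).sub (hasSum_bailey_transform hs κ₂ hw₂)).of_eq
    (fun m => ?_) ?_
  · rw [← mul_sub, ← (hsum κ₁ hw₁ m).tsum_sub (hsum κ₂ hw₂ m), ← hc, div_eq_mul_inv,
      ← tsum_mul_right]
    congr 1
    refine tsum_congr fun j => ?_
    rw [qBinom_two_mul, qBinom_two_mul]
    field_simp [qPoch_ne_zero hp hp (2 * m)]
  · rw [(hsum' κ₁ hQ₁).tsum_sub (hsum' κ₂ hQ₂), mul_sub]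
    simp only [e]

/-! ### Three Rogers–Slater sums as theta series. -/

section

variable {s : ℂ} (hs0 : s ≠ 0) (hs : ‖s‖ < 1)
include hs0 hs

/-- The quadratic part `21j²`, here and in the next two sums, is `2 · 6j² + (3j)²`: the weight in
base `s²` plus Bailey's `s^{κ²}`. -/
theorem hasSum_slater_one : HasSum (fun m : ℕ => s ^ m ^ 2 * qPoch (-s) (s ^ 2) m *
      ((s ^ 2) ^ m / qPoch (s ^ 2) (s ^ 2) (2 * m)))
    (qPochInf (-s) (s ^ 2) / qPochInf (s ^ 2) (s ^ 2) *
      ∑' j : ℤ, (s ^ (21 * j ^ 2 + 4 * j) - s ^ (21 * j ^ 2 + 10 * j + 1))) := by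
  refine (hasSum_of_qBinom_expansion hs0 hs (Q₁ := fun j => 6 * j ^ 2 + 2 * j)
    (Q₂ := fun j => 6 * j ^ 2 + 2 * j) (fun j => 3 * j) (fun j => 1 + 3 * j) (fun j => ?_)
    (fun j => ?_) fun m => ?_).of_eq (fun m => rfl) ?_
  · rcases abs_cases j with ⟨h, h'⟩ | ⟨h, h'⟩ <;> rw [h] <;> nlinarith
  · rcases abs_cases j with ⟨h, h'⟩ | ⟨h, h'⟩ <;> rw [h] <;> nlinarith
  · rw [← tsum_qBinom_pow (pow_ne_zero 2 hs0) (norm_pow_lt_one hs two_ne_zero) m]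
    simp only [add_assoc]
  · congr! 5 <;> ring

theorem hasSum_slater_two : HasSum (fun m : ℕ => s ^ m ^ 2 * qPoch (-s) (s ^ 2) m *
      (1 / qPoch (s ^ 2) (s ^ 2) (2 * m)))
    (qPochInf (-s) (s ^ 2) / qPochInf (s ^ 2) (s ^ 2) *
      ∑' j : ℤ, (s ^ (21 * j ^ 2 + 2 * j) - s ^ (21 * j ^ 2 + 16 * j + 3))) := by
  refine (hasSum_of_qBinom_expansion hs0 hs (Q₁ := fun j => 6 * j ^ 2 + j)
    (Q₂ := fun j => 6 * j ^ 2 + 5 * j + 1) (fun j => 3 * j) (fun j => 1 + 3 * j) (fun j => ?_)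
    (fun j => ?_) fun m => ?_).of_eq (fun m => rfl) ?_
  · rcases abs_cases j with ⟨h, h'⟩ | ⟨h, h'⟩ <;> rw [h] <;> nlinarith
  · rcases abs_cases j with ⟨h, h'⟩ | ⟨h, h'⟩ <;> rw [h] <;> nlinarith
  · rw [← tsum_qBinom_even (pow_ne_zero 2 hs0) (norm_pow_lt_one hs two_ne_zero) m]
    simp only [add_assoc]
  · congr! 5 <;> ring

theorem hasSum_slater_three : HasSum (fun m : ℕ => s ^ m ^ 2 * qPoch (-s) (s ^ 2) m *
      ((1 - (s ^ 2) ^ (2 * m)) / qPoch (s ^ 2) (s ^ 2) (2 * m)))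
    (qPochInf (-s) (s ^ 2) / qPochInf (s ^ 2) (s ^ 2) *
      ∑' j : ℤ, (s ^ (21 * j ^ 2 + 8 * j + 1) - s ^ (21 * j ^ 2 + 20 * j + 5))) := by
  refine (hasSum_of_qBinom_expansion hs0 hs (Q₁ := fun j => 6 * j ^ 2 + j)
    (Q₂ := fun j => 6 * j ^ 2 + 7 * j + 2) (fun j => 1 + 3 * j) (fun j => 1 + 3 * j) (fun j => ?_)
    (fun j => ?_) fun m => ?_).of_eq (fun m => rfl) ?_
  · rcases abs_cases j with ⟨h, h'⟩ | ⟨h, h'⟩ <;> rw [h] <;> nlinarith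
  · rcases abs_cases j with ⟨h, h'⟩ | ⟨h, h'⟩ <;> rw [h] <;> nlinarith
  · rw [← tsum_qBinom_one_sub (pow_ne_zero 2 hs0) (norm_pow_lt_one hs two_ne_zero) m]
    simp only [add_assoc]
  · congr! 5 <;> ring

end

/-! ### The Jacobi triple product, from its finite form. -/

section finiteTripleProduct

variable {t z : ℂ} (ht0 : t ≠ 0) (ht : ‖t‖ < 1) (hz0 : z ≠ 0)
include ht0 ht hz0

/-- After Pascal's rule, the shift `k ↦ k + 1` makes the remainder `-z t^{2n}` times the main sum.
The odd step is the mirror image, with the other rule and the shift `k ↦ k - 1`. -/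
theorem tsum_qBinom_even_theta (n : ℕ) :
    ∑' k : ℤ, (-z) ^ k * t ^ (k ^ 2 - k) * qBinom (t ^ 2) (2 * n + 1 + 1) (n + 1 + 1 * k) =
      (1 - z * (t ^ 2) ^ n) *
        ∑' k : ℤ, (-z) ^ k * t ^ (k ^ 2 - k) * qBinom (t ^ 2) (2 * n + 1) (n + 1 + 1 * k) := by
  have hp := norm_pow_lt_one ht two_ne_zero
  have hp0 : t ^ 2 ≠ 0 := pow_ne_zero 2 ht0
  have hz0' : -z ≠ 0 := neg_ne_zero.2 hz0
  have h1 := summable_mul_qBinom (t ^ 2) (2 * n + 1) (fun k => (-z) ^ k * t ^ (k ^ 2 - k)) (n + 1)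
    le_rfl
  have h2 := summable_mul_qBinom (t ^ 2) (2 * n + 1)
    (fun k => (-z) ^ k * t ^ (k ^ 2 - k) * (t ^ 2) ^ (n + 1 - k)) n le_rfl
  have h3 : ∑' k : ℤ, (-z) ^ k * t ^ (k ^ 2 - k) * (t ^ 2) ^ (n + 1 - k) *
      qBinom (t ^ 2) (2 * n + 1) (n + 1 * k) = -(z * (t ^ 2) ^ n) *
        ∑' k : ℤ, (-z) ^ k * t ^ (k ^ 2 - k) * qBinom (t ^ 2) (2 * n + 1) (n + 1 + 1 * k) := by
    rw [← (Equiv.addRight (1 : ℤ)).tsum_eq, ← tsum_mul_left]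
    refine tsum_congr fun k => ?_
    simp only [Equiv.coe_addRight]
    rw [show (n : ℤ) + 1 * (k + 1) = n + 1 + 1 * k by ring, zpow_add_one₀ hz0',
      show (k + 1) ^ 2 - (k + 1) = k ^ 2 - k + 2 * k by ring, zpow_add₀ ht0, zpow_mul,
      add_sub_add_right_eq_sub, zpow_sub₀ hp0, zpow_natCast]
    have : (t ^ (2 : ℤ)) ^ k ≠ 0 := zpow_ne_zero _ (by simpa using hp0)
    rw [show t ^ 2 = t ^ (2 : ℤ) from rfl]
    field_simp
  rw [sub_mul, one_mul, sub_eq_add_neg, ← neg_mul, ← h3, ← h1.tsum_add h2]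
  refine tsum_congr fun k => ?_
  rw [qBinom_succ' hp0 hp, show (n : ℤ) + 1 + 1 * k - 1 = n + 1 * k by ring]
  push_cast
  rw [show (2 * (n : ℤ) + 1 + 1 - (n + 1 + 1 * k)) = n + 1 - k by ring]
  ring

theorem tsum_qBinom_odd_theta (n : ℕ) :
    ∑' k : ℤ, (-z) ^ k * t ^ (k ^ 2 - k) * qBinom (t ^ 2) (2 * n + 1) (n + 1 + 1 * k) =
      (1 - t ^ 2 / z * (t ^ 2) ^ n) *
        ∑' k : ℤ, (-z) ^ k * t ^ (k ^ 2 - k) * qBinom (t ^ 2) (2 * n) (n + 1 * k) := by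
  have hp := norm_pow_lt_one ht two_ne_zero
  have hp0 : t ^ 2 ≠ 0 := pow_ne_zero 2 ht0
  have hz0' : -z ≠ 0 := neg_ne_zero.2 hz0
  have h1 := summable_mul_qBinom (t ^ 2) (2 * n) (fun k => (-z) ^ k * t ^ (k ^ 2 - k)) n le_rfl
  have h2 := summable_mul_qBinom (t ^ 2) (2 * n)
    (fun k => (-z) ^ k * t ^ (k ^ 2 - k) * (t ^ 2) ^ (n + 1 + k)) (n + 1) le_rfl
  have h3 : ∑' k : ℤ, (-z) ^ k * t ^ (k ^ 2 - k) * (t ^ 2) ^ (n + 1 + k) *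
      qBinom (t ^ 2) (2 * n) (n + 1 + 1 * k) = -(t ^ 2 / z * (t ^ 2) ^ n) *
        ∑' k : ℤ, (-z) ^ k * t ^ (k ^ 2 - k) * qBinom (t ^ 2) (2 * n) (n + 1 * k) := by
    rw [← (Equiv.subRight (1 : ℤ)).tsum_eq, ← tsum_mul_left]
    refine tsum_congr fun k => ?_
    simp only [Equiv.subRight_apply]
    rw [show (n : ℤ) + 1 + 1 * (k - 1) = n + 1 * k by ring, zpow_sub_one₀ hz0',
      show (k - 1) ^ 2 - (k - 1) = k ^ 2 - k + (2 * (-k) + 2) by ring, zpow_add₀ ht0,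
      zpow_add₀ ht0 (2 * -k), zpow_mul,
      show (n : ℤ) + 1 + (k - 1) = n + k by ring, zpow_add₀ hp0, zpow_natCast, zpow_neg]
    have : (t ^ (2 : ℤ)) ^ k ≠ 0 := zpow_ne_zero _ (by simpa using hp0)
    rw [show t ^ 2 = t ^ (2 : ℤ) from rfl]
    field_simp
  rw [sub_mul, one_mul, sub_eq_add_neg, ← neg_mul, ← h3, ← h1.tsum_add h2]
  refine tsum_congr fun k => ?_
  rw [qBinom_succ hp0 hp, show (n : ℤ) + 1 + 1 * k - 1 = n + 1 * k by ring,
    show (n : ℤ) + 1 + 1 * k = n + 1 + k by ring]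
  ring

/-- The finite form of the Jacobi triple product identity. -/
theorem tsum_qBinom_theta (n : ℕ) :
    ∑' k : ℤ, (-z) ^ k * t ^ (k ^ 2 - k) * qBinom (t ^ 2) (2 * n) (n + 1 * k) =
      qPoch z (t ^ 2) n * qPoch (t ^ 2 / z) (t ^ 2) n := by
  induction n with
  | zero =>
    rw [tsum_eq_single 0 fun j hj => ?_]
    · simp [qBinom_zero_zero, qPoch_zero]
    · rw [qBinom_eq_zero, mul_zero]
      push_cast; lia
  | succ n ih =>
    rw [qPoch_succ, qPoch_succ, mul_mul_mul_comm, ← ih]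
    have h1 := tsum_qBinom_even_theta ht0 ht hz0 n
    rw [tsum_qBinom_odd_theta ht0 ht hz0] at h1
    push_cast
    refine h1.trans ?_
    ring

end finiteTripleProduct

theorem tendsto_invQPoch_add {p : ℂ} (hp : ‖p‖ < 1) {f : ℕ → ℤ} (hf : Tendsto f atTop atTop) :
    Tendsto (fun n => invQPoch p (f n)) atTop (𝓝 (qPochInf p p)⁻¹) := by
  have h1 : Tendsto (fun n => (f n).toNat) atTop atTop :=
    tendsto_atTop.2 fun b => (tendsto_atTop.1 hf b).mono fun n hn => by lia
  refine (((tendsto_qPoch p hp).comp h1).inv₀ (qPochInf_ne_zero_of_norm_lt hp hp)).congr' ?_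
  filter_upwards [tendsto_atTop.1 hf 0] with n hn
  rw [invQPoch, if_neg (by lia)]
  rfl

/-- The Jacobi triple product identity. -/
theorem hasSum_jacobi {t z : ℂ} (ht0 : t ≠ 0) (ht : ‖t‖ < 1) (hz0 : z ≠ 0)
    (hsum : Summable fun k : ℤ => ‖(-z) ^ k * t ^ (k ^ 2 - k)‖) :
    HasSum (fun k : ℤ => (-z) ^ k * t ^ (k ^ 2 - k))
      (qPochInf (t ^ 2) (t ^ 2) * qPochInf z (t ^ 2) * qPochInf (t ^ 2 / z) (t ^ 2)) := by
  have hp := norm_pow_lt_one ht two_ne_zero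
  have hP := qPochInf_ne_zero_of_norm_lt hp hp
  obtain ⟨C, hC0, hC⟩ := exists_norm_qPoch_le (t ^ 2) hp
  obtain ⟨D, hD0, hD⟩ := exists_norm_invQPoch_le hp
  -- The limit is taken termwise in the finite form by dominated convergence: the central binomials
  -- tend to `1 / (t²; t²)_∞` and are uniformly bounded.
  have h1 : Tendsto (fun n : ℕ => ∑' k : ℤ, (-z) ^ k * t ^ (k ^ 2 - k) *
      qBinom (t ^ 2) (2 * n) (n + 1 * k)) atTop
      (𝓝 (∑' k : ℤ, (-z) ^ k * t ^ (k ^ 2 - k) * (qPochInf (t ^ 2) (t ^ 2))⁻¹)) := by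
    refine tendsto_tsum_of_dominated_convergence (hsum.mul_right (C * (D * D))) (fun k => ?_)
      (Eventually.of_forall fun n k => ?_)
    · refine Tendsto.const_mul _ ?_
      have h2 : Tendsto (fun n : ℕ => qPoch (t ^ 2) (t ^ 2) (2 * n)) atTop
          (𝓝 (qPochInf (t ^ 2) (t ^ 2))) :=
        (tendsto_qPoch (t ^ 2) hp).comp (tendsto_id.const_mul_atTop' two_pos)
      have h3 := tendsto_invQPoch_add hp (f := fun n : ℕ => (n : ℤ) + 1 * k)
        (tendsto_atTop_add_const_right _ _ tendsto_natCast_atTop_atTop)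
      have h4 := tendsto_invQPoch_add hp (f := fun n : ℕ => ((2 * n : ℕ) : ℤ) - (n + 1 * k)) <| by
        refine (tendsto_atTop_add_const_right atTop (-k)
          (tendsto_natCast_atTop_atTop (R := ℤ))).congr fun n => ?_
        push_cast; ring
      have h5 := h2.mul (h3.mul h4)
      rwa [mul_inv_cancel_left₀ hP] at h5
    · rw [norm_mul]
      gcongr
      rw [qBinom, norm_mul, norm_mul]
      gcongr
      · exact hC _
      · exact hD _
      · exact hD _
  have h2 := ((tendsto_qPoch z hp).mul (tendsto_qPoch (t ^ 2 / z) hp))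
  have h3 := tendsto_nhds_unique h1
    (h2.congr fun n => (tsum_qBinom_theta ht0 ht hz0 n).symm)
  rw [tsum_mul_right] at h3
  rw [mul_assoc, ← h3, mul_left_comm, mul_inv_cancel₀ hP, mul_one]
  exact hsum.of_norm.hasSum

/-! ### Pentagonal series and the quintuple product. -/

section

variable {s : ℂ} (hs0 : s ≠ 0) (hs : ‖s‖ < 1)
include hs0 hs

theorem summable_jacobi_pow {b a : ℕ} (ha : 0 < a) (hab : a < 2 * b) :
    Summable fun k : ℤ => ‖(-1 : ℂ) ^ k * s ^ (b * (k ^ 2 - k) + a * k)‖ := by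
  have h := summable_norm_zpow hs0 hs (Q := fun k : ℤ => b * (k ^ 2 - k) + a * k) fun k => by
    zify at ha hab
    rcases le_or_gt 0 k with hk | hk
    · rw [abs_of_nonneg hk]
      have : 0 ≤ k ^ 2 - k := by nlinarith
      nlinarith
    · rw [abs_of_neg hk]
      have : 0 ≤ k ^ 2 + k := by nlinarith
      nlinarith
  refine h.congr fun k => ?_
  rw [norm_mul, norm_zpow (-1 : ℂ), norm_neg, norm_one, one_zpow, one_mul]

theorem hasSum_jacobi_pow {b a : ℕ} (ha : 0 < a) (hab : a < 2 * b) :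
    HasSum (fun k : ℤ => (-1 : ℂ) ^ k * s ^ (b * (k ^ 2 - k) + a * k))
      (qPochInf (s ^ (2 * b)) (s ^ (2 * b)) * qPochInf (s ^ a) (s ^ (2 * b)) *
        qPochInf (s ^ (2 * b - a)) (s ^ (2 * b))) := by
  have e : ∀ k : ℤ, (-s ^ a) ^ k * (s ^ b) ^ (k ^ 2 - k) =
      (-1 : ℂ) ^ k * s ^ (b * (k ^ 2 - k) + a * k) := by
    intro k
    rw [neg_eq_neg_one_mul, mul_zpow, zpow_add₀ hs0, zpow_mul, zpow_mul, zpow_natCast, zpow_natCast]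
    ring
  have hb : b ≠ 0 := by lia
  have h := hasSum_jacobi (pow_ne_zero b hs0) (norm_pow_lt_one hs hb) (pow_ne_zero a hs0)
    (by simpa only [e] using summable_jacobi_pow hs0 hs ha hab)
  refine h.of_eq (fun k => (e k).symm) ?_
  rw [← pow_mul, mul_comm b 2, pow_sub₀ s hs0 hab.le, div_eq_mul_inv]

theorem hasSum_pentagonal : HasSum (fun k : ℤ => (-1 : ℂ) ^ k * s ^ (42 * k ^ 2 + 14 * k))
    (qPochInf (s ^ 28) (s ^ 28)) := by
  -- The three factors have base `s^84` and arguments `s^28`, `s^56`, `s^84`: the three residue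
  -- classes of `(s^28; s^28)_∞`.
  refine (hasSum_jacobi_pow hs0 hs (b := 42) (a := 56) (by norm_num) (by norm_num)).of_eq
    (fun k => ?_) ?_
  · push_cast
    congr 2; ring
  · rw [qPochInf_eq_prod _ (norm_pow_lt_one hs (by norm_num : 28 ≠ 0)) three_ne_zero]
    simp only [prod_range_succ, prod_range_zero, ← pow_mul, ← pow_add]
    norm_num
    ring

theorem hasSum_pentagonal_neg : HasSum (fun k : ℤ => (-1 : ℂ) ^ k * s ^ (42 * k ^ 2 - 14 * k))
    (qPochInf (s ^ 28) (s ^ 28)) := by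
  refine ((Equiv.neg ℤ).hasSum_iff.2 (hasSum_pentagonal hs0 hs)).of_eq (fun k => ?_) rfl
  simp only [Function.comp, Equiv.neg_apply, zpow_neg, ← inv_zpow, inv_neg, inv_one]
  congr 2; ring

omit hs0 hs in
-- The reflection `k ↦ 1 - k` fixes `k² - k` and flips the sign.
theorem tsum_alternating_eq_zero : ∑' k : ℤ, (-1 : ℂ) ^ k * s ^ (42 * (k ^ 2 - k)) = 0 := by
  have h := (Equiv.subLeft (1 : ℤ)).tsum_eq fun k : ℤ => (-1 : ℂ) ^ k * s ^ (42 * (k ^ 2 - k))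
  have h2 : ∀ k : ℤ, (-1 : ℂ) ^ (1 - k) * s ^ (42 * ((1 - k) ^ 2 - (1 - k))) =
      -((-1 : ℂ) ^ k * s ^ (42 * (k ^ 2 - k))) := by
    intro k
    rw [zpow_sub₀ (by norm_num), zpow_one, div_eq_mul_inv, ← inv_zpow, inv_neg, inv_one,
      show (1 - k) ^ 2 - (1 - k) = k ^ 2 - k by ring]
    ring
  simp only [Equiv.subLeft_apply, h2, tsum_neg] at h
  linear_combination (-1 / 2 : ℂ) * h

/-- The quintuple product identity in base `s ^ 14`, at `z = s ^ a`. -/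
theorem quintuple_product {a : ℕ} (ha : 0 < a) (ha7 : a < 7) :
    ∑' m : ℤ, (s ^ (21 * m ^ 2 - 7 * m + 3 * a * m) - s ^ (21 * m ^ 2 + 7 * m + 3 * a * m + a)) =
      qPochInf (s ^ 14) (s ^ 14) * qPochInf (s ^ a) (s ^ 14) * qPochInf (s ^ (14 - a)) (s ^ 14) *
        (qPochInf (s ^ (14 + 2 * a)) (s ^ 28) * qPochInf (s ^ (14 - 2 * a)) (s ^ 28)) := by
  have hX := hasSum_jacobi_pow hs0 hs (b := 7) ha (by lia)
  have hY := hasSum_jacobi_pow hs0 hs (b := 14) (a := 14 + 2 * a) (by lia) (by lia)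
  have hXs := summable_jacobi_pow hs0 hs (b := 7) ha (by lia)
  have hYs := summable_jacobi_pow hs0 hs (b := 14) (a := 14 + 2 * a) (by lia) (by lia)
  push_cast at hX hY hXs hYs
  have hprod := summable_mul_of_summable_norm hXs hYs
  have hXY := hX.mul hY hprod
  set f : ℤ × ℤ → ℂ := fun x => (-1 : ℂ) ^ x.1 * s ^ (7 * (x.1 ^ 2 - x.1) + a * x.1) *
    ((-1 : ℂ) ^ x.2 * s ^ (14 * (x.2 ^ 2 - x.2) + (14 + 2 * a) * x.2)) with hf
  -- In the product of the two triple products, the new variable `n = i + 2j` absorbs all dependence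
  -- on `a`. The sum over `j` at fixed `n` then depends, up to a signed power of `s`, only on `n mod
  -- 3`.
  let e : ℤ × ℤ ≃ ℤ × ℤ :=
    { toFun := fun x => (x.1 - 2 * x.2, x.2)
      invFun := fun x => (x.1 + 2 * x.2, x.2)
      left_inv := fun x => by simp
      right_inv := fun x => by simp }
  have hfe : Summable (f ∘ e) := e.summable_iff.2 hprod
  set c : ℤ → ℂ := fun n => ∑' j, f (n - 2 * j, j) with hc
  have hcs : Summable c := hfe.prod
  have hc1 : ∑' x, f x = ∑' n, c n := by
    rw [← e.tsum_eq f]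
    exact hfe.tsum_prod
  have hc2 : ∑' n, c n = ∑' m : ℤ, (c (m * 3) + c (m * 3 + 1) + c (m * 3 + 2)) := by
    have h1 := (Int.divModEquiv 3).symm.summable_iff.2 hcs
    rw [← (Int.divModEquiv 3).symm.tsum_eq c]
    refine h1.tsum_prod.trans (tsum_congr fun m => ?_)
    rw [tsum_fintype, Fin.sum_univ_three]
    simp [Int.divModEquiv]
  have hterm : ∀ n m l : ℤ, f (n - 2 * (l + m), l + m) = (-1 : ℂ) ^ (n - l - m) *
      s ^ (7 * (n ^ 2 - n) + a * n + 42 * (l + m) ^ 2 - 28 * n * (l + m) + 14 * (l + m)) := by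
    intro n m l
    simp only [hf]
    rw [mul_mul_mul_comm, ← zpow_add₀ (by norm_num), ← zpow_add₀ hs0]
    congr 2 <;> ring
  have hsgn : ∀ k l : ℤ, (-1 : ℂ) ^ (2 * k + l) = (-1) ^ l := by
    intro k l
    rw [zpow_add₀ (by norm_num), zpow_mul]
    norm_num
  -- For `n = 3m + r`, centring at `j = l + m` gives the exponent `42l² + (14 - 28r)l` plus a
  -- constant: two pentagonal series for `r = 0, 1`, and a vanishing series for `r = 2`.
  have hshift : ∀ n m : ℤ, c n = ∑' l, f (n - 2 * (l + m), l + m) := fun n m =>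
    ((Equiv.addRight m).tsum_eq fun j => f (n - 2 * j, j)).symm
  have h0 : ∀ m : ℤ, c (m * 3) =
      s ^ (21 * m ^ 2 - 7 * m + 3 * a * m) * qPochInf (s ^ 28) (s ^ 28) := by
    intro m
    rw [hshift _ m, ← (hasSum_pentagonal hs0 hs).tsum_eq, ← tsum_mul_left]
    refine tsum_congr fun l => ?_
    rw [hterm, mul_left_comm (s ^ _), ← zpow_add₀ hs0,
      show m * 3 - l - m = 2 * (m - l) + l by ring, hsgn]
    congr 2; ring
  have h1 : ∀ m : ℤ, c (m * 3 + 1) =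
      -(s ^ (21 * m ^ 2 + 7 * m + 3 * a * m + a) * qPochInf (s ^ 28) (s ^ 28)) := by
    intro m
    rw [hshift _ m, ← (hasSum_pentagonal_neg hs0 hs).tsum_eq, ← tsum_mul_left, ← tsum_neg]
    refine tsum_congr fun l => ?_
    rw [hterm, mul_left_comm, ← zpow_add₀ hs0,
      show m * 3 + 1 - l - m = 2 * (m - l) + (l + 1) by ring, hsgn,
      zpow_add_one₀ (by norm_num), mul_neg_one, neg_mul]
    congr 3; ring
  have h2 : ∀ m : ℤ, c (m * 3 + 2) = 0 := by
    intro m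
    rw [hshift _ m, ← mul_zero (s ^ (21 * m ^ 2 + 21 * m + 14 + 3 * a * m + 2 * a)),
      ← tsum_alternating_eq_zero (s := s), ← tsum_mul_left]
    refine tsum_congr fun l => ?_
    rw [hterm, mul_left_comm, ← zpow_add₀ hs0,
      show m * 3 + 2 - l - m = 2 * (m + 1 - l) + l by ring, hsgn]
    congr 2; ring
  have hne : qPochInf (s ^ 28) (s ^ 28) ≠ 0 :=
    qPochInf_ne_zero_of_norm_lt (norm_pow_lt_one hs (by norm_num)) (norm_pow_lt_one hs (by norm_num))
  have key : (∑' m : ℤ, (s ^ (21 * m ^ 2 - 7 * m + 3 * a * m) -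
      s ^ (21 * m ^ 2 + 7 * m + 3 * a * m + a))) * qPochInf (s ^ 28) (s ^ 28) = ∑' x, f x := by
    rw [hc1, hc2, ← tsum_mul_right]
    refine tsum_congr fun m => ?_
    rw [h0, h1, h2]
    ring
  rw [hXY.tsum_eq, show 2 * 14 - (14 + 2 * a) = 14 - 2 * a by lia] at key
  refine mul_right_cancel₀ hne (key.trans ?_)
  ring

end

/-! ### Factorizations of generating functions, as formal power series. -/

section PowerSeriesIdentities
open PowerSeries

/-- The generating function of `1 / (p; p)_n`. -/
noncomputable def eulerSeries (p : ℂ) : PowerSeries ℂ := mk fun n => (qPoch p p n)⁻¹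

/-- The expansion of `1 / (X²; p²)_∞`. -/
noncomputable def evenEulerSeries (p : ℂ) : PowerSeries ℂ :=
  mk fun n => if Even n then (qPoch (p ^ 2) (p ^ 2) (n / 2))⁻¹ else 0

/-- The expansion of `(-X; p²)_∞`. -/
noncomputable def dualEulerSeries (p : ℂ) : PowerSeries ℂ :=
  mk fun n => p ^ (n * (n - 1)) * (qPoch (p ^ 2) (p ^ 2) n)⁻¹

/-- A linear `r`-difference equation determines its solution from the constant term. Once the lower
coefficients of `D = F - G` vanish, comparison in degree `n + 1` reads `(r^(n+1) - 1) D_{n+1} = 0`.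
-/
theorem PowerSeries.eq_of_rescale_eq {F G U V : PowerSeries ℂ} {r : ℂ}
    (hr : ∀ n : ℕ, r ^ (n + 1) ≠ 1) (hU : coeff 0 U = 1) (hV : coeff 0 V = 1)
    (hF : U * rescale r F = V * F) (hG : U * rescale r G = V * G) (h0 : coeff 0 F = coeff 0 G) :
    F = G := by
  have hD : U * rescale r (F - G) = V * (F - G) := by rw [map_sub, mul_sub, mul_sub, hF, hG]
  have hz : ∀ n, coeff n (F - G) = 0 := by
    intro n
    induction n using Nat.strong_induction_on with
    | _ n ih =>
      cases n with
      | zero => rw [map_sub, h0, sub_self]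
      | succ n =>
        have h := congrArg (coeff (n + 1)) hD
        rw [coeff_mul, coeff_mul, sum_eq_single (0, n + 1), sum_eq_single (0, n + 1)] at h
        · rw [coeff_rescale, hU, hV] at h
          have h2 : (r ^ (n + 1) - 1) * coeff (n + 1) (F - G) = 0 := by linear_combination h
          exact (mul_eq_zero.1 h2).resolve_left (sub_ne_zero.2 (hr n))
        · rintro ⟨i, j⟩ hij hne
          have := mem_antidiagonal.1 hij
          have hi : i ≠ 0 := by
            rintro rfl
            exact hne (by simpa using this)
          rw [ih j (by simp at this; lia), mul_zero]
        · simp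
        · rintro ⟨i, j⟩ hij hne
          have := mem_antidiagonal.1 hij
          have hi : i ≠ 0 := by
            rintro rfl
            exact hne (by simpa using this)
          rw [coeff_rescale, ih j (by simp at this; lia), mul_zero, mul_zero]
        · simp
  exact sub_eq_zero.1 (PowerSeries.ext fun n => by simpa using hz n)

variable {p : ℂ} (hp : ‖p‖ < 1)
include hp

theorem inv_qPoch_succ (n : ℕ) :
    (1 - p ^ (n + 1)) * (qPoch p p (n + 1))⁻¹ = (qPoch p p n)⁻¹ := by
  have h2 : 1 - p * p ^ n ≠ 0 := sub_ne_zero.2 (mul_pow_ne_one hp hp n).symm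
  rw [qPoch_succ, pow_succ', mul_inv]
  field_simp

theorem rescale_eulerSeries : rescale p (eulerSeries p) = (1 - X) * eulerSeries p := by
  ext n
  rw [coeff_rescale, sub_mul, one_mul, map_sub]
  cases n with
  | zero => simp [eulerSeries]
  | succ n =>
    rw [coeff_succ_X_mul, eulerSeries, coeff_mk, coeff_mk, ← inv_qPoch_succ hp n]
    ring

theorem rescale_evenEulerSeries :
    rescale p (evenEulerSeries p) = (1 - X ^ 2) * evenEulerSeries p := by
  ext n
  rw [coeff_rescale, sub_mul, one_mul, map_sub]
  rcases n with _ | _ | n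
  · simp [evenEulerSeries, coeff_X_pow_mul']
  · simp [evenEulerSeries, coeff_X_pow_mul']
  · rw [show n + 1 + 1 = n + 2 from rfl, coeff_X_pow_mul, evenEulerSeries, coeff_mk, coeff_mk]
    by_cases h : Even n
    · obtain ⟨k, rfl⟩ := h
      have h1 : Even (k + k + 2) := ⟨k + 1, by ring⟩
      have h2 : Even (k + k) := ⟨k, rfl⟩
      rw [if_pos h1, if_pos h2, show (k + k + 2) / 2 = k + 1 by lia,
        show (k + k) / 2 = k by lia, ← inv_qPoch_succ (norm_pow_lt_one hp two_ne_zero) k,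
        ← pow_mul]
      ring
    · have h1 : ¬ Even (n + 2) := by simpa [Nat.even_add_one] using h
      rw [if_neg h, if_neg h1]
      ring

theorem one_add_X_mul_rescale_dualEulerSeries :
    (1 + X) * rescale (p ^ 2) (dualEulerSeries p) = dualEulerSeries p := by
  ext n
  rw [add_mul, one_mul, map_add]
  cases n with
  | zero => simp [dualEulerSeries]
  | succ n =>
    rw [coeff_succ_X_mul, coeff_rescale, coeff_rescale, dualEulerSeries, coeff_mk, coeff_mk,
      ← inv_qPoch_succ (norm_pow_lt_one hp two_ne_zero) n]
    have : p ^ ((n + 1) * (n + 1 - 1)) = p ^ (n * (n - 1)) * (p ^ 2) ^ n := by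
      rw [add_mul_add_sub_one, ← pow_mul, ← pow_add]
      simp
    rw [this]
    ring

theorem pow_succ_ne_one (n : ℕ) : p ^ (n + 1) ≠ 1 := by
  rw [pow_succ']
  exact mul_pow_ne_one hp hp n

/-- In product form, `(X²; p⁴)_∞ = (X; p²)_∞ (-X; p²)_∞`. -/
theorem dualEulerSeries_mul_evenEulerSeries_sq :
    dualEulerSeries p * evenEulerSeries (p ^ 2) = eulerSeries (p ^ 2) := by
  have hp2 := norm_pow_lt_one hp two_ne_zero
  refine PowerSeries.eq_of_rescale_eq (U := 1 + X) (V := 1 - X ^ 2) (r := p ^ 2)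
    (pow_succ_ne_one hp2) (by simp) (by simp) ?_ ?_ ?_
  · rw [map_mul, ← mul_assoc, one_add_X_mul_rescale_dualEulerSeries hp,
      rescale_evenEulerSeries hp2]
    ring
  · rw [rescale_eulerSeries hp2]
    ring
  · simp [dualEulerSeries, evenEulerSeries, eulerSeries, qPoch_zero]

theorem rescale_sq_evenEulerSeries : rescale (p ^ 2) (evenEulerSeries p) =
    (1 - C (p ^ 2) * X ^ 2) * ((1 - X ^ 2) * evenEulerSeries p) := by
  rw [sq p, ← rescale_rescale, rescale_evenEulerSeries hp, map_mul, map_sub, map_one, map_pow,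
    rescale_X, rescale_evenEulerSeries hp, mul_pow, map_mul, sq (C p)]

theorem rescale_sq_eulerSeries : rescale (p ^ 2) (eulerSeries p) =
    (1 - C p * X) * ((1 - X) * eulerSeries p) := by
  rw [sq p, ← rescale_rescale, rescale_eulerSeries hp, map_mul, map_sub, map_one,
    rescale_X, rescale_eulerSeries hp]

theorem rescale_rescale_eulerSeries_sq (y : ℂ) :
    rescale (p ^ 2) (rescale y (eulerSeries (p ^ 2))) =
      (1 - C y * X) * rescale y (eulerSeries (p ^ 2)) := by
  rw [rescale_rescale, mul_comm, ← rescale_rescale,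
    rescale_eulerSeries (norm_pow_lt_one hp two_ne_zero), map_mul, map_sub, map_one, rescale_X]

/-- In product form, `(X²; p²)_∞ = (X; p)_∞ (-X; p²)_∞ (-pX; p²)_∞`, and the numerator `(-X; p²)_∞`
cancels. In the next lemma the numerator is `(-pX; p²)_∞`, which cancels the other factor. -/
theorem dualEulerSeries_mul_evenEulerSeries :
    dualEulerSeries p * evenEulerSeries p =
      rescale (-p) (eulerSeries (p ^ 2)) * eulerSeries p := by
  have hp2 := norm_pow_lt_one hp two_ne_zero
  refine PowerSeries.eq_of_rescale_eq (U := 1 + X)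
    (V := (1 - X ^ 2) * (1 - C (p ^ 2) * X ^ 2)) (r := p ^ 2)
    (pow_succ_ne_one hp2) (by simp) (by simp) ?_ ?_ ?_
  · rw [map_mul, ← mul_assoc, one_add_X_mul_rescale_dualEulerSeries hp,
      rescale_sq_evenEulerSeries hp]
    ring
  · rw [map_mul, rescale_rescale_eulerSeries_sq hp, rescale_sq_eulerSeries hp, map_neg, map_pow]
    ring
  · simp only [coeff_mul, Nat.antidiagonal_zero, sum_singleton, coeff_rescale]
    simp [dualEulerSeries, evenEulerSeries, eulerSeries, qPoch_zero]

theorem rescale_dualEulerSeries_mul_evenEulerSeries :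
    rescale p (dualEulerSeries p) * evenEulerSeries p =
      rescale (-1) (eulerSeries (p ^ 2)) * eulerSeries p := by
  have hp2 := norm_pow_lt_one hp two_ne_zero
  refine PowerSeries.eq_of_rescale_eq (U := 1 + C p * X)
    (V := (1 - X ^ 2) * (1 - C (p ^ 2) * X ^ 2)) (r := p ^ 2)
    (pow_succ_ne_one hp2) (by simp) (by simp) ?_ ?_ ?_
  · have h := congrArg (rescale p) (one_add_X_mul_rescale_dualEulerSeries hp)
    rw [map_mul, map_add, map_one, rescale_X, rescale_rescale] at h
    rw [map_mul, ← mul_assoc, rescale_rescale, mul_comm p, h, rescale_sq_evenEulerSeries hp]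
    ring
  · rw [map_mul, rescale_rescale_eulerSeries_sq hp, rescale_sq_eulerSeries hp, map_neg, map_pow,
      map_one]
    ring
  · simp only [coeff_mul, Nat.antidiagonal_zero, sum_singleton, coeff_rescale]
    simp [dualEulerSeries, evenEulerSeries, eulerSeries, qPoch_zero]

end PowerSeriesIdentities

/-! ### Regrouping double sums by Cauchy products. -/

section regroup
open PowerSeries

theorem tsum_mul_coeff_mul_coeff {W : ℕ → ℂ} {F H : PowerSeries ℂ}
    (h : Summable fun x : ℕ × ℕ => W (x.1 + x.2) * (coeff x.1 F * coeff x.2 H)) :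
    ∑' x : ℕ × ℕ, W (x.1 + x.2) * (coeff x.1 F * coeff x.2 H) = ∑' n, W n * coeff n (F * H) := by
  rw [tsum_prod_eq_tsum_antidiagonal h]
  refine tsum_congr fun n => ?_
  rw [coeff_mul, mul_sum]
  exact sum_congr rfl fun x hx => by rw [mem_antidiagonal.1 hx]

/-- A weight in `i + 2k` becomes one in an ordinary Cauchy product once the terms are extended by
zero off the image of `(i, k) ↦ (i, 2k)`. -/
theorem tsum_mul_coeff_evenEulerSeries {p : ℂ} {W : ℕ → ℂ} {F : PowerSeries ℂ}
    (h : Summable fun x : ℕ × ℕ =>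
      W (x.1 + 2 * x.2) * (coeff x.1 F * (qPoch (p ^ 2) (p ^ 2) x.2)⁻¹)) :
    ∑' x : ℕ × ℕ, W (x.1 + 2 * x.2) * (coeff x.1 F * (qPoch (p ^ 2) (p ^ 2) x.2)⁻¹) =
      ∑' n, W n * coeff n (F * evenEulerSeries p) := by
  set f : ℕ × ℕ → ℂ := fun x => W (x.1 + x.2) * (coeff x.1 F * coeff x.2 (evenEulerSeries p))
    with hf
  set g : ℕ × ℕ → ℕ × ℕ := fun x => (x.1, 2 * x.2) with hg
  have hfg : ∀ x : ℕ × ℕ, W (x.1 + 2 * x.2) * (coeff x.1 F * (qPoch (p ^ 2) (p ^ 2) x.2)⁻¹) =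
      f (g x) := fun x => by simp [hf, hg, evenEulerSeries]
  have hgi : Function.Injective g := fun x y hxy => by
    simp only [hg, Prod.mk.injEq] at hxy
    exact Prod.ext hxy.1 (by lia)
  have h0 : ∀ x, x ∉ Set.range g → f x = 0 := by
    intro x hx
    have : ¬ Even x.2 := by
      rintro ⟨k, hk⟩
      exact hx ⟨(x.1, k), Prod.ext rfl (by simp [hg, hk]; lia)⟩
    simp [hf, evenEulerSeries, this]
  simp only [hfg] at h ⊢
  have hs : Summable f := (hgi.summable_iff h0).1 h
  rw [hgi.tsum_eq (fun x hx => by_contra fun h => hx (h0 x h)), tsum_mul_coeff_mul_coeff hs]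

end regroup

/-! ### From the double sum to the Rogers–Slater sums. -/

theorem summable_pow_add {r : ℝ} (h0 : 0 ≤ r) (h1 : r < 1) :
    Summable fun x : ℕ × ℕ => r ^ (x.1 + x.2) := by
  simp only [pow_add]
  exact (summable_geometric_of_lt_one h0 h1).mul_of_nonneg (summable_geometric_of_lt_one h0 h1)
    (fun _ => by positivity) fun _ => by positivity

theorem norm_zpow_le_pow {q : ℂ} (hq0 : q ≠ 0) (hq : ‖q‖ < 1) {a : ℤ} {n : ℕ} (h : (n : ℤ) ≤ a) :
    ‖q ^ a‖ ≤ ‖q‖ ^ n := by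
  rw [norm_zpow, ← zpow_natCast]
  exact zpow_le_zpow_right_of_le_one₀ (norm_pos_iff.2 hq0) hq.le h

/-- The double sum to which the four families of triple sums reduce. -/
noncomputable def nahmPairTerm (q : ℂ) (α β : ℤ) (x : ℕ × ℕ) : ℂ :=
  q ^ (3 * x.1 ^ 2 + 4 * x.1 * x.2 + 4 * x.2 ^ 2 + α * x.1 + β * x.2 : ℤ) *
    ((qPoch (q ^ 4) (q ^ 4) x.1)⁻¹ * (qPoch (q ^ 4) (q ^ 4) x.2)⁻¹)

section

variable {q : ℂ} (hq0 : q ≠ 0) (hq : ‖q‖ < 1)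
include hq0 hq

theorem summable_nahmPairTerm {α β : ℤ} (hα : -2 ≤ α) (hβ : 0 ≤ β) :
    Summable (nahmPairTerm q α β) := by
  have hq4 := norm_pow_lt_one hq four_ne_zero
  obtain ⟨C, hC0, hC⟩ := exists_norm_inv_qPoch_le hq4 hq4
  refine Summable.of_norm_bounded ((summable_pow_add (norm_nonneg q) hq).mul_right (C * C))
    fun x => ?_
  rw [nahmPairTerm, norm_mul, norm_mul]
  have h : ((x.1 + x.2 : ℕ) : ℤ) ≤
      3 * x.1 ^ 2 + 4 * x.1 * x.2 + 4 * x.2 ^ 2 + α * x.1 + β * x.2 := by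
    have h1 : (0 : ℤ) ≤ x.1 * x.2 := by positivity
    have h2 : (x.1 : ℤ) ≤ x.1 ^ 2 := by exact_mod_cast Nat.le_self_pow two_ne_zero _
    have h3 : (x.2 : ℤ) ≤ x.2 ^ 2 := by exact_mod_cast Nat.le_self_pow two_ne_zero _
    push_cast
    nlinarith
  gcongr
  · exact norm_zpow_le_pow hq0 hq h
  · exact hC _
  · exact hC _

omit hq0 hq in
theorem qPoch_two_mul (m : ℕ) : qPoch (q ^ 2) (q ^ 2) (2 * m) =
    qPoch (q ^ 4) (q ^ 4) m * (qPoch q (q ^ 2) m * qPoch (-q) (q ^ 2) m) := by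
  induction m with
  | zero => simp [qPoch_zero]
  | succ m ih =>
    rw [show 2 * (m + 1) = 2 * m + 1 + 1 by ring]
    simp only [qPoch_succ, ih]
    ring

omit hq0 in
-- Splits `(-q; q²)_∞` at `m` and uses `(q²; q²)_{2m} = (q⁴; q⁴)_m (q; q²)_m (-q; q²)_m`. This
-- produces the Rogers–Slater summand with `s = -q`.
theorem qPochInf_mul_inv_qPoch (m : ℕ) :
    qPochInf (-q ^ (1 + 2 * m)) (q ^ 2) * (qPoch (q ^ 4) (q ^ 4) m)⁻¹ =
      qPochInf (-q) (q ^ 2) * (qPoch q (q ^ 2) m / qPoch (q ^ 2) (q ^ 2) (2 * m)) := by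
  have hq2 := norm_pow_lt_one hq two_ne_zero
  have hq4 := norm_pow_lt_one hq four_ne_zero
  have h1 := qPoch_ne_zero hq hq2 m
  have h2 := qPoch_ne_zero (a := -q) (by rwa [norm_neg]) hq2 m
  have h3 := qPoch_ne_zero hq4 hq4 m
  rw [qPoch_two_mul, qPochInf_eq_mul (-q) hq2 m,
    show -q * (q ^ 2) ^ m = -q ^ (1 + 2 * m) by ring]
  field_simp

omit hq0 in
theorem qPochInf_neg_mul_div :
    qPochInf (-q) (q ^ 2) * (qPochInf q (q ^ 2) / qPochInf (q ^ 2) (q ^ 2)) = (J q 4)⁻¹ := by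
  have hq2 := norm_pow_lt_one hq two_ne_zero
  have hq4 := norm_pow_lt_one hq four_ne_zero
  have h1 := qPochInf_sq q hq2
  have h2 := qPochInf_eq_prod (q ^ 2) hq2 two_ne_zero
  simp only [prod_range_succ, prod_range_zero, ← pow_mul, ← pow_add] at h1 h2
  norm_num at h1 h2
  have h3 : qPochInf (q ^ 2) (q ^ 4) ≠ 0 := qPochInf_ne_zero_of_norm_lt hq2 hq4
  have h4 : qPochInf (q ^ 4) (q ^ 4) ≠ 0 := qPochInf_ne_zero_of_norm_lt hq4 hq4
  rw [J, mul_div_assoc', mul_comm (qPochInf (-q) _), ← h1, h2]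
  field_simp

open PowerSeries in
omit hq0 in
/-- The passage from the double sum to a single sum. -/
theorem tsum_pair_eq_tsum {W V : ℕ → ℂ} {F : PowerSeries ℂ} {y : ℂ} {z : ℕ → ℂ} (hy : ‖y‖ ≤ 1)
    (hF : F * evenEulerSeries (q ^ 2) =
      rescale y (eulerSeries ((q ^ 2) ^ 2)) * eulerSeries (q ^ 2))
    (hW : ∀ n, ‖W n‖ ≤ ‖q‖ ^ n)
    (hWV : ∀ m i, W (m + i) = V m * (q ^ (i * (i - 1)) * (-z m) ^ i))
    (hs : Summable fun x : ℕ × ℕ =>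
      W (x.1 + 2 * x.2) * (coeff x.1 F * (qPoch ((q ^ 2) ^ 2) ((q ^ 2) ^ 2) x.2)⁻¹)) :
    ∑' x : ℕ × ℕ, W (x.1 + 2 * x.2) * (coeff x.1 F * (qPoch ((q ^ 2) ^ 2) ((q ^ 2) ^ 2) x.2)⁻¹) =
      ∑' m, V m * y ^ m * (qPochInf (z m) (q ^ 2) * (qPoch (q ^ 4) (q ^ 4) m)⁻¹) := by
  have hq2 := norm_pow_lt_one hq two_ne_zero
  have hq4 := norm_pow_lt_one hq2 two_ne_zero
  obtain ⟨C, hC0, hC⟩ := exists_norm_inv_qPoch_le hq2 hq2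
  obtain ⟨D, hD0, hD⟩ := exists_norm_inv_qPoch_le hq4 hq4
  have hs2 : Summable fun x : ℕ × ℕ => W (x.1 + x.2) *
      (coeff x.1 (rescale y (eulerSeries ((q ^ 2) ^ 2))) * coeff x.2 (eulerSeries (q ^ 2))) := by
    refine Summable.of_norm_bounded ((summable_pow_add (norm_nonneg q) hq).mul_right (1 * D * C))
      fun x => ?_
    rw [coeff_rescale, eulerSeries, eulerSeries, coeff_mk, coeff_mk, norm_mul, norm_mul, norm_mul,
      norm_pow]
    gcongr
    · exact hW _
    · exact pow_le_one₀ (norm_nonneg y) hy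
    · exact hD _
    · exact hC _
  -- After `hF`, `n` splits anew as `m + i`, with `m` from the rescaled factor and `i` from
  -- `eulerSeries (q ^ 2)`. By `hWV` the sum over `i` is Euler's expansion of `(z m; q²)_∞`.
  rw [tsum_mul_coeff_evenEulerSeries hs, hF, ← tsum_mul_coeff_mul_coeff hs2, hs2.tsum_prod]
  refine tsum_congr fun m => ?_
  rw [← (hasSum_euler hq (z m)).tsum_eq, ← tsum_mul_right, ← tsum_mul_left]
  refine tsum_congr fun i => ?_
  rw [hWV, coeff_rescale, eulerSeries, eulerSeries, coeff_mk, coeff_mk, ← pow_mul]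
  ring

omit hq0 hq in
theorem neg_pow_sq (m : ℕ) : (-q) ^ m ^ 2 = q ^ m ^ 2 * (-1) ^ m := by
  rw [neg_pow, mul_comm]
  congr 1
  rw [sq, pow_mul]
  rcases m.even_or_odd with h | h <;> simp [h.neg_one_pow]

omit hq0 in
theorem norm_pow_le_pow {n m : ℕ} (h : n ≤ m) : ‖q ^ m‖ ≤ ‖q‖ ^ n := by
  rw [norm_pow]
  exact pow_le_pow_of_le_one (norm_nonneg q) hq.le h

omit hq0 hq in
theorem pow_add_sq (m i : ℕ) :
    q ^ (m + i) ^ 2 = q ^ m ^ 2 * (q ^ (i * (i - 1)) * (- -q ^ (1 + 2 * m)) ^ i) := by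
  rw [neg_neg, ← pow_mul, ← pow_add, ← pow_add]
  congr 1
  cases i with
  | zero => simp
  | succ i => simp; ring

open PowerSeries in
-- The exponent is `(i + 2j)² + 2i(i - 1)`, so the weight is `q^{n²}` and the factor in `i` is a
-- coefficient of `dualEulerSeries (q ^ 2)`.
theorem tsum_nahmPairTerm_one : ∑' x, nahmPairTerm q (-2) 0 x = (J q 4)⁻¹ *
    ∑' j : ℤ, ((-q) ^ (21 * j ^ 2 + 4 * j) - (-q) ^ (21 * j ^ 2 + 10 * j + 1)) := by
  have hq2 := norm_pow_lt_one hq two_ne_zero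
  have e : ∀ x : ℕ × ℕ, nahmPairTerm q (-2) 0 x = q ^ (x.1 + 2 * x.2) ^ 2 *
      (coeff x.1 (dualEulerSeries (q ^ 2)) * (qPoch ((q ^ 2) ^ 2) ((q ^ 2) ^ 2) x.2)⁻¹) := by
    intro x
    have : (q ^ 2) ^ (x.1 * (x.1 - 1)) = q ^ (2 * x.1 ^ 2 - 2 * x.1 : ℤ) := by
      rw [← pow_mul, ← zpow_natCast]
      congr 1
      cases x.1 with
      | zero => rfl
      | succ m => push_cast [Nat.add_sub_cancel]; ring
    rw [nahmPairTerm, dualEulerSeries, coeff_mk, this, ← pow_mul, ← zpow_natCast q ((_) ^ 2),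
      mul_assoc (q ^ _), ← mul_assoc (q ^ (((x.1 + 2 * x.2) ^ 2 : ℕ) : ℤ)), ← zpow_add₀ hq0]
    congr 2
    push_cast; ring
  have h1 := hasSum_slater_one (neg_ne_zero.2 hq0) (by rwa [norm_neg])
  simp only [neg_neg, even_two.neg_pow] at h1
  have h2 := (summable_congr e).1 (summable_nahmPairTerm hq0 hq (α := -2) (β := 0) le_rfl le_rfl)
  rw [tsum_congr e, tsum_pair_eq_tsum hq (V := fun m => q ^ m ^ 2) (z := fun m => -q ^ (1 + 2 * m))
    (y := -(q ^ 2)) (by rw [norm_neg]; exact hq2.le) (dualEulerSeries_mul_evenEulerSeries hq2)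
    (fun n => norm_pow_le_pow hq (Nat.le_self_pow two_ne_zero n)) pow_add_sq h2,
    ← qPochInf_neg_mul_div hq, mul_assoc, ← h1.tsum_eq, ← tsum_mul_left]
  refine tsum_congr fun m => ?_
  rw [qPochInf_mul_inv_qPoch hq, neg_pow_sq, neg_pow (q ^ 2)]
  ring

open PowerSeries in
-- Now the exponent is `(i + 2j)² + 2i(i - 1) + 2i`; the extra `2i` is the rescaling by `q²`.
theorem tsum_nahmPairTerm_two : ∑' x, nahmPairTerm q 0 0 x = (J q 4)⁻¹ *
    ∑' j : ℤ, ((-q) ^ (21 * j ^ 2 + 2 * j) - (-q) ^ (21 * j ^ 2 + 16 * j + 3)) := by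
  have hq2 := norm_pow_lt_one hq two_ne_zero
  have e : ∀ x : ℕ × ℕ, nahmPairTerm q 0 0 x = q ^ (x.1 + 2 * x.2) ^ 2 *
      (coeff x.1 (rescale (q ^ 2) (dualEulerSeries (q ^ 2))) *
        (qPoch ((q ^ 2) ^ 2) ((q ^ 2) ^ 2) x.2)⁻¹) := by
    intro x
    have : (q ^ 2) ^ x.1 * ((q ^ 2) ^ (x.1 * (x.1 - 1)) * (qPoch ((q ^ 2) ^ 2) ((q ^ 2) ^ 2) x.1)⁻¹)
        = q ^ (2 * x.1 ^ 2 : ℤ) * (qPoch ((q ^ 2) ^ 2) ((q ^ 2) ^ 2) x.1)⁻¹ := by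
      rw [← mul_assoc]
      congr 1
      rw [← pow_mul, ← pow_mul, ← pow_add, ← zpow_natCast]
      congr 1
      cases x.1 with
      | zero => rfl
      | succ m => push_cast [Nat.add_sub_cancel]; ring
    rw [nahmPairTerm, coeff_rescale, dualEulerSeries, coeff_mk, this, ← pow_mul,
      ← zpow_natCast q ((_) ^ 2),
      mul_assoc (q ^ _), ← mul_assoc (q ^ (((x.1 + 2 * x.2) ^ 2 : ℕ) : ℤ)), ← zpow_add₀ hq0]
    congr 2
    push_cast; ring
  have h1 := hasSum_slater_two (neg_ne_zero.2 hq0) (by rwa [norm_neg])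
  simp only [neg_neg, even_two.neg_pow] at h1
  have h2 := (summable_congr e).1 (summable_nahmPairTerm hq0 hq (α := 0) (β := 0) (by norm_num) le_rfl)
  rw [tsum_congr e, tsum_pair_eq_tsum hq (V := fun m => q ^ m ^ 2) (z := fun m => -q ^ (1 + 2 * m))
    (y := -1) (by simp) (rescale_dualEulerSeries_mul_evenEulerSeries hq2)
    (fun n => norm_pow_le_pow hq (Nat.le_self_pow two_ne_zero n)) pow_add_sq h2,
    ← qPochInf_neg_mul_div hq, mul_assoc, ← h1.tsum_eq, ← tsum_mul_left]
  refine tsum_congr fun m => ?_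
  rw [qPochInf_mul_inv_qPoch hq, neg_pow_sq]
  ring

open PowerSeries in
-- The linear part `2i + 4j` is `2n`, so the weight is `q^{n² + 2n} = q^{(n+1)² - 1}`. This shift of
-- the single sum is why `1 - p^{2m}` appears.
theorem tsum_nahmPairTerm_three : ∑' x, nahmPairTerm q 2 4 x = (J q 4)⁻¹ *
    ∑' j : ℤ, ((-q) ^ (21 * j ^ 2 + 8 * j) - (-q) ^ (21 * j ^ 2 + 20 * j + 4)) := by
  have hq2 := norm_pow_lt_one hq two_ne_zero
  have hq4 := norm_pow_lt_one hq four_ne_zero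
  have hq0' := neg_ne_zero.2 hq0
  have e : ∀ x : ℕ × ℕ, nahmPairTerm q 2 4 x = q ^ ((x.1 + 2 * x.2) ^ 2 + 2 * (x.1 + 2 * x.2)) *
      (coeff x.1 (rescale (q ^ 2) (dualEulerSeries (q ^ 2))) *
        (qPoch ((q ^ 2) ^ 2) ((q ^ 2) ^ 2) x.2)⁻¹) := by
    intro x
    have : (q ^ 2) ^ x.1 * ((q ^ 2) ^ (x.1 * (x.1 - 1)) * (qPoch ((q ^ 2) ^ 2) ((q ^ 2) ^ 2) x.1)⁻¹)
        = q ^ (2 * x.1 ^ 2 : ℤ) * (qPoch ((q ^ 2) ^ 2) ((q ^ 2) ^ 2) x.1)⁻¹ := by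
      rw [← mul_assoc]
      congr 1
      rw [← pow_mul, ← pow_mul, ← pow_add, ← zpow_natCast]
      congr 1
      cases x.1 with
      | zero => rfl
      | succ m => push_cast [Nat.add_sub_cancel]; ring
    rw [nahmPairTerm, coeff_rescale, dualEulerSeries, coeff_mk, this, ← pow_mul,
      ← zpow_natCast q (_ + _),
      mul_assoc (q ^ _), ← mul_assoc (q ^ (((x.1 + 2 * x.2) ^ 2 + _ : ℕ) : ℤ)), ← zpow_add₀ hq0]
    congr 2
    push_cast; ring
  have h1 := hasSum_slater_three hq0' (by rwa [norm_neg])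
  simp only [neg_neg, even_two.neg_pow] at h1
  have h2 := (summable_congr e).1 (summable_nahmPairTerm hq0 hq (α := 2) (β := 4) (by norm_num) (by norm_num))
  have h3 : ∑' j : ℤ, ((-q) ^ (21 * j ^ 2 + 8 * j) - (-q) ^ (21 * j ^ 2 + 20 * j + 4)) =
      (-q)⁻¹ * ∑' j : ℤ, ((-q) ^ (21 * j ^ 2 + 8 * j + 1) - (-q) ^ (21 * j ^ 2 + 20 * j + 5)) := by
    rw [← tsum_mul_left]
    refine tsum_congr fun j => ?_
    rw [zpow_add_one₀ hq0', show 21 * j ^ 2 + 20 * j + 5 = 21 * j ^ 2 + 20 * j + 4 + 1 by ring,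
      zpow_add_one₀ hq0']
    generalize -q = s at hq0' ⊢
    field_simp
  rw [tsum_congr e, tsum_pair_eq_tsum hq (W := fun n => q ^ (n ^ 2 + 2 * n)) (V := fun m => q ^ (m ^ 2 + 2 * m))
    (z := fun m => -q ^ (1 + 2 * (m + 1)))
    (y := -1) (by simp) (rescale_dualEulerSeries_mul_evenEulerSeries hq2)
    (fun n => norm_pow_le_pow hq (by nlinarith)) ?_ h2, h3,
    ← qPochInf_neg_mul_div hq, mul_left_comm, mul_assoc, ← h1.tsum_eq, h1.summable.tsum_eq_zero_add]
  -- The term `m = 0` of the Rogers–Slater sum vanishes. Its term `m + 1` matches term `m` here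
  -- through `1 / (q⁴; q⁴)_m = (1 - q^{4(m+1)}) / (q⁴; q⁴)_{m+1}`; the spare power of `s = -q` is
  -- the factor `(-q)⁻¹`.
  · simp only [mul_zero, pow_zero, sub_self, zero_div, zero_add]
    rw [← tsum_mul_left, ← tsum_mul_left]
    refine tsum_congr fun m => ?_
    have h4 := qPochInf_mul_inv_qPoch hq (m + 1)
    have h5 := inv_qPoch_succ hq4 m
    rw [← h5, mul_left_comm (qPochInf _ _), h4, neg_pow_sq, ← pow_mul q 4, ← pow_mul q 2,
      show 4 * (m + 1) = 2 * (2 * (m + 1)) by ring,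
      show (m + 1) ^ 2 = m ^ 2 + 2 * m + 1 by ring, pow_succ q (_ + _), pow_succ (-1 : ℂ) m, inv_neg]
    generalize q ^ (m ^ 2 + 2 * m) = a
    generalize 1 - q ^ (2 * (2 * (m + 1))) = b
    generalize qPochInf (-q) (q ^ 2) = c
    generalize qPoch q (q ^ 2) (m + 1) = d
    generalize qPoch (q ^ 2) (q ^ 2) (2 * (m + 1)) = e
    linear_combination (-(a * (-1) ^ m * (b * (c * (d / e))))) * inv_mul_cancel₀ hq0
  · intro m i
    rw [neg_neg, ← pow_mul, ← pow_add, ← pow_add]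
    congr 1
    cases i with
    | zero => simp
    | succ i => simp; ring

end

/-! ### Product evaluations modulo 28. -/

theorem J_ne_zero {q : ℂ} (hq : ‖q‖ < 1) {m : ℕ} (hm : m ≠ 0) : J q m ≠ 0 :=
  qPochInf_ne_zero_of_norm_lt (norm_pow_lt_one hq hm) (norm_pow_lt_one hq hm)

theorem Jtheta_ne_zero {q : ℂ} (hq : ‖q‖ < 1) {a m : ℕ} (ha : 0 < a) (ham : a < m) :
    Jtheta q a m ≠ 0 := by
  have hm := norm_pow_lt_one hq (n := m) (by lia)
  exact mul_ne_zero (mul_ne_zero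
    (qPochInf_ne_zero_of_norm_lt (norm_pow_lt_one hq (by lia)) hm)
    (qPochInf_ne_zero_of_norm_lt (norm_pow_lt_one hq (by lia)) hm))
    (qPochInf_ne_zero_of_norm_lt hm hm)

section

variable {q : ℂ} (hq : ‖q‖ < 1)
include hq

/-- The multiples of 4 modulo 28 pair up as `{4, 24}`, `{8, 20}`, `{12, 16}`, with 28 left over. -/
theorem J_four_mul : J q 4 * J q 28 ^ 2 = Jtheta q 4 28 * Jtheta q 8 28 * Jtheta q 12 28 := by
  have h := qPochInf_eq_prod (q ^ 4) (norm_pow_lt_one hq four_ne_zero) (n := 7) (by norm_num)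
  simp only [prod_range_succ, prod_range_zero, ← pow_mul, ← pow_add] at h
  norm_num at h
  simp only [J, Jtheta, h]
  norm_num
  ring

theorem qPochInf_bisect (a : ℕ) :
    qPochInf (q ^ a) (q ^ 14) = qPochInf (q ^ a) (q ^ 28) * qPochInf (q ^ (a + 14)) (q ^ 28) := by
  have h := qPochInf_eq_prod (q ^ a) (norm_pow_lt_one hq (n := 14) (by norm_num)) two_ne_zero
  simp only [prod_range_succ, prod_range_zero, ← pow_mul, ← pow_add] at h
  norm_num at h
  exact h

theorem qPochInf_pow_two_mul (a : ℕ) :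
    qPochInf (q ^ (2 * a)) (q ^ 28) = qPochInf (q ^ a) (q ^ 14) * qPochInf (-q ^ a) (q ^ 14) := by
  have h := qPochInf_sq (q ^ a) (norm_pow_lt_one hq (n := 14) (by norm_num))
  simp only [← pow_mul] at h
  rw [mul_comm a] at h
  exact h

/-- The two theta factors combine to `(q^a; q^14)_∞ (q^(14-a); q^14)_∞ J_28²`, and `(x; q^14)_∞ (-x;
q^14)_∞ = (x²; q^28)_∞` removes the signs. -/
theorem quintuple_product_mul_Jtheta {a : ℕ} (ha7 : a < 7) :
    qPochInf (q ^ 14) (q ^ 14) * qPochInf (-q ^ a) (q ^ 14) * qPochInf (-q ^ (14 - a)) (q ^ 14) *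
        (qPochInf (q ^ (14 + 2 * a)) (q ^ 28) * qPochInf (q ^ (14 - 2 * a)) (q ^ 28)) *
      (Jtheta q a 28 * Jtheta q (14 - a) 28) =
    J q 14 * Jtheta q (2 * a) 28 * Jtheta q (14 - 2 * a) 28 := by
  simp only [J, Jtheta]
  rw [show 28 - 2 * a = 2 * (14 - a) by lia, qPochInf_pow_two_mul hq, qPochInf_pow_two_mul hq,
    qPochInf_bisect hq a, qPochInf_bisect hq (14 - a), show 14 - a + 14 = 28 - a by lia,
    show 28 - (14 - a) = a + 14 by lia, show 28 - (14 - 2 * a) = 14 + 2 * a by lia]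
  ring

/-- The quintuple product identity at `z = (-q) ^ a`. -/
theorem quintuple_product_neg (hq0 : q ≠ 0) {a : ℕ} (hodd : Odd a) (ha7 : a < 7) :
    ∑' m : ℤ, ((-q) ^ (21 * m ^ 2 - 7 * m + 3 * a * m) -
        (-q) ^ (21 * m ^ 2 + 7 * m + 3 * a * m + a)) * (Jtheta q a 28 * Jtheta q (14 - a) 28) =
      J q 14 * Jtheta q (2 * a) 28 * Jtheta q (14 - 2 * a) 28 := by
  have h1 : Odd (14 - a) := by
    obtain ⟨k, rfl⟩ := hodd
    exact ⟨6 - k, by lia⟩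
  have h2 : Even (14 - 2 * a) := ⟨7 - a, by lia⟩
  have h3 : Even (14 + 2 * a) := ⟨7 + a, by lia⟩
  rw [tsum_mul_right, quintuple_product (neg_ne_zero.2 hq0) (by rwa [norm_neg]) hodd.pos ha7,
    ← quintuple_product_mul_Jtheta hq ha7, hodd.neg_pow, h1.neg_pow, h2.neg_pow, h3.neg_pow,
    (by decide : Even 14).neg_pow, (by decide : Even 28).neg_pow]

end

section

variable {q : ℂ} (hq0 : q ≠ 0) (hq : ‖q‖ < 1)
include hq0 hq

theorem summable_neg_zpow {Q : ℤ → ℤ} (hQ : ∀ j, |j| ≤ Q j) : Summable fun j => (-q) ^ Q j :=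
  (summable_norm_zpow (neg_ne_zero.2 hq0) (by rwa [norm_neg]) hQ).of_norm

theorem tsum_nahmPairTerm_one_eq : ∑' x, nahmPairTerm q (-2) 0 x =
    J q 14 * J q 28 ^ 2 * Jtheta q 2 28 /
      (Jtheta q 1 28 * Jtheta q 4 28 * Jtheta q 8 28 * Jtheta q 13 28) := by
  have h1 := quintuple_product_neg hq hq0 odd_one (by norm_num)
  have h2 := J_four_mul hq
  have hs1 := summable_neg_zpow hq0 hq (Q := fun j => 21 * j ^ 2 + 4 * j) fun j => by
    rcases abs_cases j with ⟨h, h'⟩ | ⟨h, h'⟩ <;> rw [h] <;> nlinarith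
  have hs2 := summable_neg_zpow hq0 hq (Q := fun j => 21 * j ^ 2 + 10 * j + 1) fun j => by
    rcases abs_cases j with ⟨h, h'⟩ | ⟨h, h'⟩ <;> rw [h] <;> nlinarith
  have hs3 := (Equiv.neg ℤ).summable_iff.2 hs1
  -- For `a = 1` the first series matches the quintuple product only after `j ↦ -j`, so the two
  -- series are separated first.
  have h3 : ∑' j : ℤ, ((-q) ^ (21 * j ^ 2 + 4 * j) - (-q) ^ (21 * j ^ 2 + 10 * j + 1)) =
      ∑' m : ℤ, ((-q) ^ (21 * m ^ 2 - 7 * m + 3 * (1 : ℕ) * m) -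
        (-q) ^ (21 * m ^ 2 + 7 * m + 3 * (1 : ℕ) * m + (1 : ℕ))) := by
    rw [hs1.tsum_sub hs2, ← (Equiv.neg ℤ).tsum_eq]
    refine (hs3.tsum_sub hs2).symm.trans (tsum_congr fun j => ?_)
    simp only [Function.comp, Equiv.neg_apply]
    push_cast
    ring_nf
  rw [tsum_mul_right, ← h3] at h1
  norm_num at h1
  rw [tsum_nahmPairTerm_one hq0 hq, inv_mul_eq_div, div_eq_div_iff (J_ne_zero hq four_ne_zero)]
  · linear_combination Jtheta q 4 28 * Jtheta q 8 28 * h1 - J q 14 * Jtheta q 2 28 * h2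
  · simp [Jtheta_ne_zero hq]

theorem tsum_nahmPairTerm_two_eq : ∑' x, nahmPairTerm q 0 0 x =
    J q 14 * J q 28 ^ 2 * Jtheta q 6 28 /
      (Jtheta q 3 28 * Jtheta q 4 28 * Jtheta q 11 28 * Jtheta q 12 28) := by
  have h1 := quintuple_product_neg hq hq0 (a := 3) (by decide) (by norm_num)
  have h2 := J_four_mul hq
  have h3 : ∑' j : ℤ, ((-q) ^ (21 * j ^ 2 + 2 * j) - (-q) ^ (21 * j ^ 2 + 16 * j + 3)) =
      ∑' m : ℤ, ((-q) ^ (21 * m ^ 2 - 7 * m + 3 * (3 : ℕ) * m) -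
        (-q) ^ (21 * m ^ 2 + 7 * m + 3 * (3 : ℕ) * m + (3 : ℕ))) := by
    refine tsum_congr fun j => ?_
    push_cast
    ring_nf
  rw [tsum_mul_right, ← h3] at h1
  norm_num at h1
  rw [tsum_nahmPairTerm_two hq0 hq, inv_mul_eq_div, div_eq_div_iff (J_ne_zero hq four_ne_zero)]
  · linear_combination Jtheta q 4 28 * Jtheta q 12 28 * h1 - J q 14 * Jtheta q 6 28 * h2
  · simp [Jtheta_ne_zero hq]

theorem tsum_nahmPairTerm_three_eq : ∑' x, nahmPairTerm q 2 4 x =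
    J q 14 * J q 28 ^ 2 * Jtheta q 10 28 /
      (Jtheta q 5 28 * Jtheta q 8 28 * Jtheta q 9 28 * Jtheta q 12 28) := by
  have h1 := quintuple_product_neg hq hq0 (a := 5) (by decide) (by norm_num)
  have h2 := J_four_mul hq
  have hs1 := summable_neg_zpow hq0 hq (Q := fun j => 21 * j ^ 2 + 8 * j) fun j => by
    rcases abs_cases j with ⟨h, h'⟩ | ⟨h, h'⟩ <;> rw [h] <;> nlinarith
  have hs2 := summable_neg_zpow hq0 hq (Q := fun j => 21 * j ^ 2 + 20 * j + 4) fun j => by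
    rcases abs_cases j with ⟨h, h'⟩ | ⟨h, h'⟩ <;> rw [h] <;> nlinarith
  have hs3 := (Equiv.subLeft (-1 : ℤ)).summable_iff.2 hs2
  -- For `a = 5` it is the second series that has to be reflected, by `j ↦ -1 - j`.
  have h3 : ∑' j : ℤ, ((-q) ^ (21 * j ^ 2 + 8 * j) - (-q) ^ (21 * j ^ 2 + 20 * j + 4)) =
      ∑' m : ℤ, ((-q) ^ (21 * m ^ 2 - 7 * m + 3 * (5 : ℕ) * m) -
        (-q) ^ (21 * m ^ 2 + 7 * m + 3 * (5 : ℕ) * m + (5 : ℕ))) := by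
    rw [hs1.tsum_sub hs2, ← (Equiv.subLeft (-1 : ℤ)).tsum_eq fun j => (-q) ^ (21 * j ^ 2 + 20 * j + 4)]
    refine (hs1.tsum_sub hs3).symm.trans (tsum_congr fun j => ?_)
    simp only [Function.comp, Equiv.subLeft_apply]
    push_cast
    ring_nf
  rw [tsum_mul_right, ← h3] at h1
  norm_num at h1
  rw [tsum_nahmPairTerm_three hq0 hq, inv_mul_eq_div, div_eq_div_iff (J_ne_zero hq four_ne_zero)]
  · linear_combination Jtheta q 8 28 * Jtheta q 12 28 * h1 - J q 14 * Jtheta q 10 28 * h2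
  · simp [Jtheta_ne_zero hq]

end

/-! ### Reduction of the four families to the double sum. -/

section

variable {q : ℂ} (hq0 : q ≠ 0) (hq : ‖q‖ < 1)
include hq0 hq

theorem summable_nahmTerm {r : ℕ} (hr : r ≠ 0) {Q : ℤ → ℤ → ℤ → ℤ}
    (hQ : ∀ i j k : ℕ, (i : ℤ) + j + k ≤ Q i j k) : Summable (nahmTerm q r Q) := by
  have hqr := norm_pow_lt_one hq hr
  have hq2r := norm_pow_lt_one hq (n := 2 * r) (by lia)
  obtain ⟨C, hC0, hC⟩ := exists_norm_inv_qPoch_le hqr hqr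
  obtain ⟨D, hD0, hD⟩ := exists_norm_inv_qPoch_le hq2r hq2r
  have hs : Summable fun n : ℕ × ℕ × ℕ => ‖q‖ ^ n.1 * ‖q‖ ^ (n.2.1 + n.2.2) :=
    Summable.mul_of_nonneg (f := fun n : ℕ => ‖q‖ ^ n)
      (g := fun x : ℕ × ℕ => ‖q‖ ^ (x.1 + x.2)) (summable_geometric_of_lt_one (norm_nonneg q) hq)
      (summable_pow_add (norm_nonneg q) hq) (fun _ => by positivity) fun _ => by positivity
  refine Summable.of_norm_bounded (hs.mul_right (C * C * D)) fun n => ?_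
  have h1 : ‖q ^ Q n.1 n.2.1 n.2.2‖ ≤ ‖q‖ ^ n.1 * ‖q‖ ^ (n.2.1 + n.2.2) := by
    rw [← pow_add]
    refine norm_zpow_le_pow hq0 hq ?_
    have := hQ n.1 n.2.1 n.2.2
    push_cast
    lia
  rw [nahmTerm, div_eq_mul_inv, mul_inv, mul_inv, norm_mul, norm_mul, norm_mul]
  exact mul_le_mul h1 (mul_le_mul (mul_le_mul (hC _) (hC _) (norm_nonneg _) hC0.le) (hD _)
    (norm_nonneg _) (by positivity)) (by positivity) (by positivity)

omit hq0 hq in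
theorem qPoch_sq (x : ℂ) (n : ℕ) :
    qPoch x q n * qPoch (-x) q n = qPoch (x ^ 2) (q ^ 2) n := by
  rw [qPoch, qPoch, qPoch, ← prod_mul_distrib]
  exact prod_congr rfl fun k _ => by ring

/-- Summation over `i` by Euler's identity. -/
theorem tsum_nahmTerm_two {E : ℤ → ℤ → ℤ}
    (hs : Summable (nahmTerm q 2 fun i j k => i ^ 2 + 2 * i * j + i + E j k)) :
    ∑' n, nahmTerm q 2 (fun i j k => i ^ 2 + 2 * i * j + i + E j k) n =
      J q 4 / J q 2 * ∑' x : ℕ × ℕ, q ^ E x.1 x.2 *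
        ((qPoch (q ^ 4) (q ^ 4) x.1)⁻¹ * (qPoch (q ^ 4) (q ^ 4) x.2)⁻¹) := by
  have hq2 := norm_pow_lt_one hq two_ne_zero
  have hq4 := norm_pow_lt_one hq four_ne_zero
  have hs' := (Equiv.prodComm (ℕ × ℕ) ℕ).summable_iff.2 hs
  rw [← (Equiv.prodComm (ℕ × ℕ) ℕ).tsum_eq]
  refine hs'.tsum_prod.trans ?_
  rw [← tsum_mul_left]
  refine tsum_congr fun ⟨j, k⟩ => ?_
  have h1 := qPochInf_sq (q ^ 2) hq2
  have h2 : qPochInf (-q ^ 2) (q ^ 2) = qPoch (-q ^ 2) (q ^ 2) j *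
      qPochInf (-q ^ (2 + 2 * j)) (q ^ 2) := by
    rw [qPochInf_eq_mul _ hq2 j]
    congr 2; ring
  have h3 := qPoch_sq (q := q ^ 2) (q ^ 2) j
  simp only [← pow_mul] at h1 h3
  norm_num at h1 h3
  -- Here `(-q²; q²)_∞ = J_4 / J_2`, and its initial segment changes the base of the
  -- `j`-denominator: `(q²; q²)_j (-q²; q²)_j = (q⁴; q⁴)_j`.
  have h4 : J q 4 / J q 2 * (qPoch (q ^ 4) (q ^ 4) j)⁻¹ =
      qPochInf (-q ^ (2 + 2 * j)) (q ^ 2) * (qPoch (q ^ 2) (q ^ 2) j)⁻¹ := by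
    have h5 := qPochInf_ne_zero_of_norm_lt hq2 hq2
    have h6 := qPoch_ne_zero hq2 hq2 j
    have h7 := qPoch_ne_zero (a := -q ^ 2) (by rwa [norm_neg]) hq2 j
    rw [J, J, h1, h2, ← h3]
    field_simp
  have h8 : J q 4 / J q 2 * (q ^ E j k *
      ((qPoch (q ^ 4) (q ^ 4) j)⁻¹ * (qPoch (q ^ 4) (q ^ 4) k)⁻¹)) =
      qPochInf (-q ^ (2 + 2 * j)) (q ^ 2) * (q ^ E j k *
      ((qPoch (q ^ 2) (q ^ 2) j)⁻¹ * (qPoch (q ^ 4) (q ^ 4) k)⁻¹)) := by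
    linear_combination (q ^ E j k * (qPoch (q ^ 4) (q ^ 4) k)⁻¹) * h4
  rw [h8, ← (hasSum_euler hq (-q ^ (2 + 2 * j))).tsum_eq, ← tsum_mul_right]
  refine tsum_congr fun i => ?_
  have h9 : q ^ (i * (i - 1)) * (- -q ^ (2 + 2 * j)) ^ i = q ^ (i ^ 2 + 2 * i * j + i : ℤ) := by
    rw [neg_neg, ← pow_mul, ← pow_add, ← zpow_natCast]
    congr 1
    cases i with
    | zero => simp
    | succ i => push_cast [Nat.add_sub_cancel]; ring
  rw [h9]
  simp only [Function.comp, Equiv.prodComm_apply, Prod.swap, nahmTerm]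
  rw [zpow_add₀ hq0, div_eq_mul_inv, mul_inv, mul_inv]
  ring

open PowerSeries in
/-- Summation over `j + 2 k = N`. -/
theorem tsum_nahmTerm_four {E : ℤ → ℤ → ℤ}
    (hs : Summable (nahmTerm q 4 fun i j k => E i (j + 2 * k) + (2 * j ^ 2 - 2 * j)))
    (hs2 : Summable fun x : ℕ × ℕ => q ^ E x.1 x.2 *
        ((qPoch (q ^ 4) (q ^ 4) x.1)⁻¹ * (qPoch (q ^ 4) (q ^ 4) x.2)⁻¹)) :
    ∑' n, nahmTerm q 4 (fun i j k => E i (j + 2 * k) + (2 * j ^ 2 - 2 * j)) n =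
      ∑' x : ℕ × ℕ, q ^ E x.1 x.2 *
        ((qPoch (q ^ 4) (q ^ 4) x.1)⁻¹ * (qPoch (q ^ 4) (q ^ 4) x.2)⁻¹) := by
  have hq2 := norm_pow_lt_one hq two_ne_zero
  rw [hs.tsum_prod, hs2.tsum_prod]
  refine tsum_congr fun i => ?_
  have e : ∀ x : ℕ × ℕ, nahmTerm q 4 (fun i j k => E i (j + 2 * k) + (2 * j ^ 2 - 2 * j)) (i, x) =
      (q ^ E i (x.1 + 2 * x.2 : ℕ) * (qPoch (q ^ 4) (q ^ 4) i)⁻¹) *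
        (coeff x.1 (dualEulerSeries (q ^ 2)) *
          (qPoch (((q ^ 2) ^ 2) ^ 2) (((q ^ 2) ^ 2) ^ 2) x.2)⁻¹) := by
    intro x
    have : (q ^ 2) ^ (x.1 * (x.1 - 1)) = q ^ (2 * x.1 ^ 2 - 2 * x.1 : ℤ) := by
      rw [← pow_mul, ← zpow_natCast]
      congr 1
      cases x.1 with
      | zero => rfl
      | succ m => push_cast [Nat.add_sub_cancel]; ring
    rw [nahmTerm, dualEulerSeries, coeff_mk, this, zpow_add₀ hq0, div_eq_mul_inv, mul_inv, mul_inv]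
    push_cast
    simp only [← pow_mul]
    ring
  have hs3 := (summable_congr e).1 (hs.prod_factor i)
  rw [tsum_congr e, tsum_mul_coeff_evenEulerSeries
    (W := fun N => q ^ E i N * (qPoch (q ^ 4) (q ^ 4) i)⁻¹) hs3,
    dualEulerSeries_mul_evenEulerSeries_sq hq2]
  refine tsum_congr fun N => ?_
  rw [eulerSeries, coeff_mk, ← pow_mul]
  ring

theorem hasSum_family_one {α β : ℤ} (hα : -2 ≤ α) (hβ : 0 ≤ β) :
    HasSum (nahmTerm q 2 fun i j k =>
        i ^ 2 + 2 * i * j + i + (3 * j ^ 2 + 4 * j * k + 4 * k ^ 2 + α * j + β * k))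
      (J q 4 / J q 2 * ∑' x, nahmPairTerm q α β x) := by
  have hs := summable_nahmTerm hq0 hq two_ne_zero (Q := fun i j k =>
    i ^ 2 + 2 * i * j + i + (3 * j ^ 2 + 4 * j * k + 4 * k ^ 2 + α * j + β * k)) fun i j k => by
      have h1 : (0 : ℤ) ≤ i * j := by positivity
      have h2 : (0 : ℤ) ≤ j * k := by positivity
      have h3 : (j : ℤ) ≤ j ^ 2 := by exact_mod_cast Nat.le_self_pow two_ne_zero _
      have h4 : (k : ℤ) ≤ k ^ 2 := by exact_mod_cast Nat.le_self_pow two_ne_zero _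
      nlinarith
  have h := tsum_nahmTerm_two hq0 hq hs
  exact (hs.hasSum_iff).2 h

theorem hasSum_family_two {α β : ℤ} (hα : -2 ≤ α) (hβ : 0 ≤ β) :
    HasSum (nahmTerm q 2 fun i j k =>
        i ^ 2 + 2 * i * j + i + (3 * k ^ 2 + 4 * k * j + 4 * j ^ 2 + α * k + β * j))
      (J q 4 / J q 2 * ∑' x, nahmPairTerm q α β x) := by
  have hs := summable_nahmTerm hq0 hq two_ne_zero (Q := fun i j k =>
    i ^ 2 + 2 * i * j + i + (3 * k ^ 2 + 4 * k * j + 4 * j ^ 2 + α * k + β * j)) fun i j k => by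
      have h1 : (0 : ℤ) ≤ i * j := by positivity
      have h2 : (0 : ℤ) ≤ k * j := by positivity
      have h3 : (j : ℤ) ≤ j ^ 2 := by exact_mod_cast Nat.le_self_pow two_ne_zero _
      have h4 : (k : ℤ) ≤ k ^ 2 := by exact_mod_cast Nat.le_self_pow two_ne_zero _
      nlinarith
  refine (hs.hasSum_iff).2 ((tsum_nahmTerm_two hq0 hq
    (E := fun j k => 3 * k ^ 2 + 4 * k * j + 4 * j ^ 2 + α * k + β * j) hs).trans ?_)
  rw [← (Equiv.prodComm ℕ ℕ).tsum_eq]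
  congr 1
  refine tsum_congr fun x => ?_
  simp only [Equiv.prodComm_apply, Prod.swap, nahmPairTerm]
  rw [mul_comm (qPoch _ _ _)⁻¹]

/-- The second index of the double sum is opened up as `j + 2k`; in the fourth family it is the
first index. -/
theorem hasSum_family_three {α β : ℤ} (hα : -2 ≤ α) (hβ : 0 ≤ β) :
    HasSum (nahmTerm q 4 fun i j k =>
        (3 * i ^ 2 + 4 * i * (j + 2 * k) + 4 * (j + 2 * k) ^ 2 + α * i + β * (j + 2 * k)) +
          (2 * j ^ 2 - 2 * j))
      (∑' x, nahmPairTerm q α β x) := by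
  have hs := summable_nahmTerm hq0 hq four_ne_zero (Q := fun i j k =>
    (3 * i ^ 2 + 4 * i * (j + 2 * k) + 4 * (j + 2 * k) ^ 2 + α * i + β * (j + 2 * k)) +
      (2 * j ^ 2 - 2 * j)) fun i j k => by
      have h1 : (0 : ℤ) ≤ i * (j + 2 * k) := by positivity
      have h2 : (0 : ℤ) ≤ j * k := by positivity
      have h3 : (j : ℤ) ≤ j ^ 2 := by exact_mod_cast Nat.le_self_pow two_ne_zero _
      have h4 : (k : ℤ) ≤ k ^ 2 := by exact_mod_cast Nat.le_self_pow two_ne_zero _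
      have h5 : (i : ℤ) ≤ i ^ 2 := by exact_mod_cast Nat.le_self_pow two_ne_zero _
      have h6 : 0 ≤ β * (j + 2 * k) := by positivity
      have h7 : 0 ≤ (α + 2) * i := mul_nonneg (by linarith) (by positivity)
      nlinarith
  exact (hs.hasSum_iff).2 (tsum_nahmTerm_four hq0 hq
    (E := fun i N => 3 * i ^ 2 + 4 * i * N + 4 * N ^ 2 + α * i + β * N) hs
    (summable_nahmPairTerm hq0 hq hα hβ))

theorem hasSum_family_four {α β : ℤ} (hα : -2 ≤ α) (hβ : 0 ≤ β) :
    HasSum (nahmTerm q 4 fun i j k =>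
        (3 * (j + 2 * k) ^ 2 + 4 * (j + 2 * k) * i + 4 * i ^ 2 + α * (j + 2 * k) + β * i) +
          (2 * j ^ 2 - 2 * j))
      (∑' x, nahmPairTerm q α β x) := by
  have hs := summable_nahmTerm hq0 hq four_ne_zero (Q := fun i j k =>
    (3 * (j + 2 * k) ^ 2 + 4 * (j + 2 * k) * i + 4 * i ^ 2 + α * (j + 2 * k) + β * i) +
      (2 * j ^ 2 - 2 * j)) fun i j k => by
      have h1 : (0 : ℤ) ≤ (j + 2 * k) * i := by positivity
      have h2 : (0 : ℤ) ≤ j * k := by positivity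
      have h3 : (j : ℤ) ≤ j ^ 2 := by exact_mod_cast Nat.le_self_pow two_ne_zero _
      have h4 : (k : ℤ) ≤ k ^ 2 := by exact_mod_cast Nat.le_self_pow two_ne_zero _
      have h5 : (i : ℤ) ≤ i ^ 2 := by exact_mod_cast Nat.le_self_pow two_ne_zero _
      have h6 : 0 ≤ β * i := by positivity
      have h7 : 0 ≤ (α + 2) * (j + 2 * k) := mul_nonneg (by linarith) (by positivity)
      nlinarith
  have e : ∀ x : ℕ × ℕ, nahmPairTerm q α β x.swap =
      q ^ (3 * (x.2 : ℤ) ^ 2 + 4 * x.2 * x.1 + 4 * (x.1 : ℤ) ^ 2 + α * x.2 + β * x.1) *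
        ((qPoch (q ^ 4) (q ^ 4) x.1)⁻¹ * (qPoch (q ^ 4) (q ^ 4) x.2)⁻¹) := fun x => by
    simp only [Prod.swap, nahmPairTerm]
    rw [mul_comm (qPoch _ _ _)⁻¹]
  have hs2 := (Equiv.prodComm ℕ ℕ).summable_iff.2 (summable_nahmPairTerm hq0 hq hα hβ)
  refine (hs.hasSum_iff).2 ((tsum_nahmTerm_four hq0 hq
    (E := fun i M => 3 * M ^ 2 + 4 * M * i + 4 * i ^ 2 + α * M + β * i) hs
    ((summable_congr e).1 hs2)).trans ?_)
  rw [← (Equiv.prodComm ℕ ℕ).tsum_eq (nahmPairTerm q α β)]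
  exact (tsum_congr e).symm

end

/-! ### The degenerate case `q = 0` and the conclusion. -/

/-- The bound makes the exponent positive away from the origin, so only the term `0 ^ 0 = 1`
survives. -/
theorem hasSum_nahmTerm_zero {r : ℕ} {Q : ℤ → ℤ → ℤ → ℤ} (h0 : Q 0 0 0 = 0)
    (hQ : ∀ i j k : ℕ, (i : ℤ) + j + k ≤ Q i j k) : HasSum (nahmTerm 0 r Q) 1 := by
  have h : nahmTerm 0 r Q (0, 0, 0) = 1 := by simp [nahmTerm, h0, qPoch_zero]
  rw [← h]
  refine hasSum_single _ fun n hn => ?_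
  have h1 := hQ n.1 n.2.1 n.2.2
  have h2 : Q n.1 n.2.1 n.2.2 ≠ 0 := by
    intro h3
    exact hn (Prod.ext (by simp; lia) (Prod.ext (by simp; lia) (by simp; lia)))
  rw [nahmTerm, zero_zpow _ h2, zero_div]

theorem J_zero {m : ℕ} (hm : m ≠ 0) : J 0 m = 1 := by
  simp [J, qPochInf, hm]

theorem Jtheta_zero {a m : ℕ} (ha : 0 < a) (ham : a < m) : Jtheta 0 a m = 1 := by
  have h1 : a ≠ 0 := by lia
  have h2 : m - a ≠ 0 := by lia
  have h3 : m ≠ 0 := by lia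
  simp [Jtheta, qPochInf, h1, h2, h3]

theorem HasSum.nahmTerm_congr {q : ℂ} {r : ℕ} {Q Q' : ℤ → ℤ → ℤ → ℤ} {a b : ℂ}
    (h : HasSum (nahmTerm q r Q') b) (hQ : ∀ i j k, Q i j k = Q' i j k) (hab : a = b) :
    HasSum (nahmTerm q r Q) a := by
  have : Q = Q' := by
    funext i j k
    exact hQ i j k
  rw [this, hab]
  exact h

theorem mainTheorem10 (q : ℂ) (hq : ‖q‖ < 1) :
    (HasSum (nahmTerm q 2 fun i j k => i^2 + 3*j^2 + 4*k^2 + 2*i*j + 4*j*k + i - 2*j)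
        (J q 4 * J q 14 * J q 28 ^ 2 * Jtheta q 2 28 /
          (J q 2 * Jtheta q 1 28 * Jtheta q 4 28 * Jtheta q 8 28 * Jtheta q 13 28)) ∧
      HasSum (nahmTerm q 2 fun i j k => i^2 + 3*j^2 + 4*k^2 + 2*i*j + 4*j*k + i)
        (J q 4 * J q 14 * J q 28 ^ 2 * Jtheta q 6 28 /
          (J q 2 * Jtheta q 3 28 * Jtheta q 4 28 * Jtheta q 11 28 * Jtheta q 12 28)) ∧
      HasSum (nahmTerm q 2 fun i j k => i^2 + 3*j^2 + 4*k^2 + 2*i*j + 4*j*k + i + 2*j + 4*k)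
        (J q 4 * J q 14 * J q 28 ^ 2 * Jtheta q 10 28 /
          (J q 2 * Jtheta q 5 28 * Jtheta q 8 28 * Jtheta q 9 28 * Jtheta q 12 28))) ∧
    (HasSum (nahmTerm q 2 fun i j k => i^2 + 4*j^2 + 3*k^2 + 2*i*j + 4*j*k + i - 2*k)
        (J q 4 * J q 14 * J q 28 ^ 2 * Jtheta q 2 28 /
          (J q 2 * Jtheta q 1 28 * Jtheta q 4 28 * Jtheta q 8 28 * Jtheta q 13 28)) ∧
      HasSum (nahmTerm q 2 fun i j k => i^2 + 4*j^2 + 3*k^2 + 2*i*j + 4*j*k + i)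
        (J q 4 * J q 14 * J q 28 ^ 2 * Jtheta q 6 28 /
          (J q 2 * Jtheta q 3 28 * Jtheta q 4 28 * Jtheta q 11 28 * Jtheta q 12 28)) ∧
      HasSum (nahmTerm q 2 fun i j k => i^2 + 4*j^2 + 3*k^2 + 2*i*j + 4*j*k + i + 4*j + 2*k)
        (J q 4 * J q 14 * J q 28 ^ 2 * Jtheta q 10 28 /
          (J q 2 * Jtheta q 5 28 * Jtheta q 8 28 * Jtheta q 9 28 * Jtheta q 12 28))) ∧
    (HasSum (nahmTerm q 4 fun i j k => 3*i^2 + 6*j^2 + 16*k^2 + 4*i*j + 8*i*k + 16*j*k - 2*i - 2*j)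
        (J q 14 * J q 28 ^ 2 * Jtheta q 2 28 /
          (Jtheta q 1 28 * Jtheta q 4 28 * Jtheta q 8 28 * Jtheta q 13 28)) ∧
      HasSum (nahmTerm q 4 fun i j k => 3*i^2 + 6*j^2 + 16*k^2 + 4*i*j + 8*i*k + 16*j*k - 2*j)
        (J q 14 * J q 28 ^ 2 * Jtheta q 6 28 /
          (Jtheta q 3 28 * Jtheta q 4 28 * Jtheta q 11 28 * Jtheta q 12 28)) ∧
      HasSum (nahmTerm q 4 fun i j k => 3*i^2 + 6*j^2 + 16*k^2 + 4*i*j + 8*i*k + 16*j*k + 2*i + 2*j + 8*k)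
        (J q 14 * J q 28 ^ 2 * Jtheta q 10 28 /
          (Jtheta q 5 28 * Jtheta q 8 28 * Jtheta q 9 28 * Jtheta q 12 28))) ∧
    (HasSum (nahmTerm q 4 fun i j k => 4*i^2 + 5*j^2 + 12*k^2 + 4*i*j + 8*i*k + 12*j*k - 4*j - 4*k)
        (J q 14 * J q 28 ^ 2 * Jtheta q 2 28 /
          (Jtheta q 1 28 * Jtheta q 4 28 * Jtheta q 8 28 * Jtheta q 13 28)) ∧
      HasSum (nahmTerm q 4 fun i j k => 4*i^2 + 5*j^2 + 12*k^2 + 4*i*j + 8*i*k + 12*j*k - 2*j)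
        (J q 14 * J q 28 ^ 2 * Jtheta q 6 28 /
          (Jtheta q 3 28 * Jtheta q 4 28 * Jtheta q 11 28 * Jtheta q 12 28)) ∧
      HasSum (nahmTerm q 4 fun i j k => 4*i^2 + 5*j^2 + 12*k^2 + 4*i*j + 8*i*k + 12*j*k + 4*i + 4*k)
        (J q 14 * J q 28 ^ 2 * Jtheta q 10 28 /
          (Jtheta q 5 28 * Jtheta q 8 28 * Jtheta q 9 28 * Jtheta q 12 28))) := by
  -- Adding integer exponents requires `q ≠ 0`. At `q = 0` every product is `1`, and so is every
  -- sum.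
  rcases eq_or_ne q 0 with rfl | hq0
  · refine ⟨⟨?_, ?_, ?_⟩, ⟨?_, ?_, ?_⟩, ⟨?_, ?_, ?_⟩, ⟨?_, ?_, ?_⟩⟩
    all_goals
      simp only [ne_eq, OfNat.ofNat_ne_zero, not_false_eq_true, J_zero, Nat.ofNat_pos,
        Nat.one_lt_ofNat, Jtheta_zero, one_pow, mul_one, div_one, Nat.reduceLT,
        zero_lt_one]
      refine hasSum_nahmTerm_zero (by norm_num) fun i j k => ?_
      have h1 : (i : ℤ) ≤ i ^ 2 := by exact_mod_cast Nat.le_self_pow two_ne_zero _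
      have h2 : (j : ℤ) ≤ j ^ 2 := by exact_mod_cast Nat.le_self_pow two_ne_zero _
      have h3 : (k : ℤ) ≤ k ^ 2 := by exact_mod_cast Nat.le_self_pow two_ne_zero _
      have h4 : (0 : ℤ) ≤ i * j := by positivity
      have h5 : (0 : ℤ) ≤ i * k := by positivity
      have h6 : (0 : ℤ) ≤ j * k := by positivity
      linarith
  have e1 := tsum_nahmPairTerm_one_eq hq0 hq
  have e2 := tsum_nahmPairTerm_two_eq hq0 hq
  have e3 := tsum_nahmPairTerm_three_eq hq0 hq
  refine ⟨⟨?_, ?_, ?_⟩, ⟨?_, ?_, ?_⟩, ⟨?_, ?_, ?_⟩, ⟨?_, ?_, ?_⟩⟩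
  · exact HasSum.nahmTerm_congr (hasSum_family_one hq0 hq (α := -2) (β := 0) (by norm_num) (by norm_num))
      (fun i j k => by ring) (by rw [e1, div_mul_div_comm]; ring)
  · exact HasSum.nahmTerm_congr (hasSum_family_one hq0 hq (α := 0) (β := 0) (by norm_num) (by norm_num))
      (fun i j k => by ring) (by rw [e2, div_mul_div_comm]; ring)
  · exact HasSum.nahmTerm_congr (hasSum_family_one hq0 hq (α := 2) (β := 4) (by norm_num) (by norm_num))
      (fun i j k => by ring) (by rw [e3, div_mul_div_comm]; ring)
  · exact HasSum.nahmTerm_congr (hasSum_family_two hq0 hq (α := -2) (β := 0) (by norm_num) (by norm_num))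
      (fun i j k => by ring) (by rw [e1, div_mul_div_comm]; ring)
  · exact HasSum.nahmTerm_congr (hasSum_family_two hq0 hq (α := 0) (β := 0) (by norm_num) (by norm_num))
      (fun i j k => by ring) (by rw [e2, div_mul_div_comm]; ring)
  · exact HasSum.nahmTerm_congr (hasSum_family_two hq0 hq (α := 2) (β := 4) (by norm_num) (by norm_num))
      (fun i j k => by ring) (by rw [e3, div_mul_div_comm]; ring)
  · exact HasSum.nahmTerm_congr (hasSum_family_three hq0 hq (α := -2) (β := 0) (by norm_num) (by norm_num))
      (fun i j k => by ring) e1.symm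
  · exact HasSum.nahmTerm_congr (hasSum_family_three hq0 hq (α := 0) (β := 0) (by norm_num) (by norm_num))
      (fun i j k => by ring) e2.symm
  · exact HasSum.nahmTerm_congr (hasSum_family_three hq0 hq (α := 2) (β := 4) (by norm_num) (by norm_num))
      (fun i j k => by ring) e3.symm
  · exact HasSum.nahmTerm_congr (hasSum_family_four hq0 hq (α := -2) (β := 0) (by norm_num) (by norm_num))
      (fun i j k => by ring) e1.symm
  · exact HasSum.nahmTerm_congr (hasSum_family_four hq0 hq (α := 0) (β := 0) (by norm_num) (by norm_num))
      (fun i j k => by ring) e2.symm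
  · exact HasSum.nahmTerm_congr (hasSum_family_four hq0 hq (α := 2) (β := 4) (by norm_num) (by norm_num))
      (fun i j k => by ring) e3.symm
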